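/- Work over $\mathbb{C}$, with the classical topology on projective spaces. For $p=[A:B:C:D:E]\in\mathbb{P}^4$ let $X_p\subset\mathbb{P}^3$ be the quartic $$A(x^4+y^4+z^4+w^4)+Bxyzw+C(x^2y^2+z^2w^2)+D(x^2z^2+y^2w^2)+E(x^2w^2+y^2z^2)=0 .$$ Let $\Gamma$ be the group of transformations of $\mathbb{P}^3$ generated by $\gamma_1=[y:x:w:z]$, $\gamma_2=[z:w:x:y]$, $\gamma_3=[x:y:-z:-w]$, $\gamma_4=[x:-y:z:-w]$; it acts by the same formulas on planes $ax+by+cz+dw=0$, written $[a:b:c:d]$. Let $S_3=\{\Delta=0\}\subset\mathbb{P}^4$, $\Delta=16A^3+AB^2-4A(C^2+D^2+E^2)+4CDE$, be the Segre cubic, and $q_1=[1:0:-2:-2:2]$ one of its nodes. The fifteen singular hyperplanes are the zero sets of $A$, $q_{\pm C}=2A\pm C$, $q_{\pm D}=2A\pm D$, $q_{\pm E}=2A\pm E$, and $p_{\pm0}=4A\pm B+2C+2D+2E$, $p_{\pm1}=4A\pm B+2C-2D-2E$, $p_{\pm2}=4A\pm B-2C+2D-2E$, $p_{\pm3}=4A\pm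 B-2C-2D+2E$. Let $U\subset\mathbb{P}^4$ be the set of points $p$ that lie neither on $S_3$ nor on a singular hyperplane and for which the line through $p$ and $q_1$ meets $S_3$ in a point $p_1\neq q_1$. For $p\in U$ let $T_1(p)$ be the set of planes $[a:b:c:d]$ such that $[a:b:c:d]$ is a singular point of $X_{p_1}$. Let $\pi:\mathcal{Z}=\{(p,T):p\in U,\ T\in T_1(p)\}\to U$ be the projection, with $\mathcal Z\subset U\times\mathbb{P}^3$ carrying the subspace topology. Then $U\neq\emptyset$, $\Gamma\cong C_2^4$, and $\pi$ is a covering map. For every $p\in U$ the set $T_1(p)$ consists of exactly $16$ planes, each of which is a trope of $X_{p_1}$ (it meets $X_{p_1}$ in an irreducible conic counted twice). The monodromy group of $T_1(p)$, that is, the image of $\pi_1(U,p)$ in the permutation group of $T_1(p)$ under lifting of loops, is isomorphic to $\Gamma$, and hence to $C_2^4$; an isomorphism $\Gamma\to$ (monodromy group) is given by the action of $\Gamma$ on the planes in $T_1(p)$. Moreover, for each of the nine singular hyperplanes $H$ through $q_1$, there is a loop in $U$ based at $p$ that goes once around $H$, and every such loop acts on $T_1(p)$ by the following element of $\Gamma$: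 $$\begin{array}{c|ccccccccc} H& q_{+C}&q_{+D}&q_{-E}&p_{+0}&p_{-0}&p_{+1}&p_{-1}&p_{+2}&p_{-2}\\\hline &\gamma_3&\gamma_4&\gamma_3\gamma_4&\gamma_1\gamma_2&\gamma_1\gamma_2\gamma_3\gamma_4&\gamma_2\gamma_3\gamma_4&\gamma_2\gamma_3&\gamma_1\gamma_3\gamma_4&\gamma_1\gamma_4 \end{array}$$ Here a loop in $U$ goes once around $H$ if it is homotopic in $U$ to a path $d$ followed by $t\mapsto[u+e^{2\pi i t}v]$, $t\in[0,1]$, and the reverse of $d$, where $u,v\in\mathbb{C}^5$ are such that $u+sv\neq0$ for $|s|\le1$, $[u+sv]\in U$ for $0<|s|\le 1$, and $[u]$ lies on $H$ but not on $S_3$ or on another singular hyperplane, and the line through $[u]$ and $q_1$ meets $S_3$ in a point other than $q_1$. -/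

import Mathlib

open scoped LinearAlgebra.Projectivization

namespace HeisenbergQuartic

noncomputable section

/-- Complex projective `3`-space, with coordinates `[x : y : z : w]`. The dual space is
identified with it: `[a : b : c : d]` also stands for the plane `a x + b y + c z + d w = 0`. -/
abbrev P3 : Type := ℙ ℂ (Fin 4 → ℂ)

/-- Complex projective `4`-space, with coordinates `[A : B : C : D : E]`. -/
abbrev P4 : Type := ℙ ℂ (Fin 5 → ℂ)

/-- The classical topology of complex projective space: the quotient topology from the nonzero
vectors. -/
instance projectiveTopology (n : ℕ) : TopologicalSpace (ℙ ℂ (Fin n → ℂ)) :=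
  inferInstanceAs (TopologicalSpace (Quotient (projectivizationSetoid ℂ (Fin n → ℂ))))

/-! ### The family of quartics -/

/-- The quartic form `A(x⁴+y⁴+z⁴+w⁴) + Bxyzw + C(x²y²+z²w²) + D(x²z²+y²w²) + E(x²w²+y²z²)`
with coefficient vector `c = (A, B, C, D, E)`. -/
def quartic (c : Fin 5 → ℂ) : MvPolynomial (Fin 4) ℂ :=
  let x : MvPolynomial (Fin 4) ℂ := MvPolynomial.X 0
  let y : MvPolynomial (Fin 4) ℂ := MvPolynomial.X 1
  let z : MvPolynomial (Fin 4) ℂ := MvPolynomial.X 2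
  let w : MvPolynomial (Fin 4) ℂ := MvPolynomial.X 3
  MvPolynomial.C (c 0) * (x ^ 4 + y ^ 4 + z ^ 4 + w ^ 4)
    + MvPolynomial.C (c 1) * (x * y * z * w)
    + MvPolynomial.C (c 2) * (x ^ 2 * y ^ 2 + z ^ 2 * w ^ 2)
    + MvPolynomial.C (c 3) * (x ^ 2 * z ^ 2 + y ^ 2 * w ^ 2)
    + MvPolynomial.C (c 4) * (x ^ 2 * w ^ 2 + y ^ 2 * z ^ 2)

/-- `x` is a singular point of the surface `F = 0`. -/
def IsSingularPoint (F : MvPolynomial (Fin 4) ℂ) (x : P3) : Prop :=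
  MvPolynomial.eval x.rep F = 0 ∧
    ∀ i, MvPolynomial.eval x.rep (MvPolynomial.pderiv i F) = 0

/-- The linear form `a x + b y + c z + d w` of the plane `T = [a : b : c : d]`. -/
def planeForm (T : P3) : MvPolynomial (Fin 4) ℂ :=
  ∑ i, MvPolynomial.C (T.rep i) * MvPolynomial.X i

/-- The plane `T` is a trope of the quartic surface `F = 0`: the intersection is an irreducible
conic counted twice, that is, modulo the linear form of `T` the form `F` is the square of a
quadratic form which, modulo that linear form, is not a product of two linear forms
(in particular it is not zero). A scalar factor is absorbed in the square. -/
def IsTrope (F : MvPolynomial (Fin 4) ℂ) (T : P3) : Prop :=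
  ∃ Q : MvPolynomial (Fin 4) ℂ, Q.IsHomogeneous 2 ∧
    planeForm T ∣ F - Q ^ 2 ∧
    ∀ M N : MvPolynomial (Fin 4) ℂ, M.IsHomogeneous 1 → N.IsHomogeneous 1 →
      ¬ planeForm T ∣ Q - M * N

/-! ### The Segre cubic, its node and the singular hyperplanes -/

/-- The Segre cubic form `Δ = 16A³ + AB² - 4A(C² + D² + E²) + 4CDE`. -/
def segreCubic (c : Fin 5 → ℂ) : ℂ :=
  16 * c 0 ^ 3 + c 0 * c 1 ^ 2 - 4 * c 0 * (c 2 ^ 2 + c 3 ^ 2 + c 4 ^ 2) + 4 * c 2 * c 3 * c 4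

/-- Names of the fifteen singular hyperplanes; `p` and `m` stand for the signs `+` and `-`. -/
inductive SingularHyperplane
  | A | qpC | qmC | qpD | qmD | qpE | qmE
  | pp0 | pp1 | pp2 | pp3 | pm0 | pm1 | pm2 | pm3

/-- The linear forms that define the fifteen singular hyperplanes. -/
def SingularHyperplane.form : SingularHyperplane → (Fin 5 → ℂ) → ℂ
  | .A, c => c 0
  | .qpC, c => 2 * c 0 + c 2
  | .qmC, c => 2 * c 0 - c 2
  | .qpD, c => 2 * c 0 + c 3
  | .qmD, c => 2 * c 0 - c 3
  | .qpE, c => 2 * c 0 + c 4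
  | .qmE, c => 2 * c 0 - c 4
  | .pp0, c => 4 * c 0 + c 1 + 2 * c 2 + 2 * c 3 + 2 * c 4
  | .pp1, c => 4 * c 0 + c 1 + 2 * c 2 - 2 * c 3 - 2 * c 4
  | .pp2, c => 4 * c 0 + c 1 - 2 * c 2 + 2 * c 3 - 2 * c 4
  | .pp3, c => 4 * c 0 + c 1 - 2 * c 2 - 2 * c 3 + 2 * c 4
  | .pm0, c => 4 * c 0 - c 1 + 2 * c 2 + 2 * c 3 + 2 * c 4
  | .pm1, c => 4 * c 0 - c 1 + 2 * c 2 - 2 * c 3 - 2 * c 4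
  | .pm2, c => 4 * c 0 - c 1 - 2 * c 2 + 2 * c 3 - 2 * c 4
  | .pm3, c => 4 * c 0 - c 1 - 2 * c 2 - 2 * c 3 + 2 * c 4

/-- A coordinate vector of the node `q₁`. -/
def nodeVec : Fin 5 → ℂ := ![1, 0, -2, -2, 2]

theorem nodeVec_ne_zero : nodeVec ≠ 0 := fun h => by
  simpa [nodeVec] using congrFun h 0

/-- The node `q₁ = [1 : 0 : -2 : -2 : 2]` of the Segre cubic. -/
def node : P4 := Projectivization.mk ℂ nodeVec nodeVec_ne_zero

/-- `p₁` is the remaining point, besides the node `q₁`, in which the line through `q₁` and `p`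
meets the Segre cubic. -/
def IsResidualPoint (p p₁ : P4) : Prop :=
  p₁ ≠ node ∧ segreCubic p₁.rep = 0 ∧ p₁.submodule ≤ node.submodule ⊔ p.submodule

/-- The set `T₁` over `p`: the planes dual to the singular points of the surface of the residual
point of `p`. -/
def tropeSet (p : P4) : Set P3 :=
  {T | ∃ p₁ : P4, IsResidualPoint p p₁ ∧ IsSingularPoint (quartic p₁.rep) T}

/-- `p` is off the Segre cubic, off every singular hyperplane that is not in `S`, and has a
residual point. -/
def IsGeneralOutside (S : Set SingularHyperplane) (p : P4) : Prop :=
  segreCubic p.rep ≠ 0 ∧ (∀ H ∉ S, H.form p.rep ≠ 0) ∧ ∃ p₁, IsResidualPoint p p₁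

/-- The locus of general parameters, over which the tropes are studied. -/
def generalLocus : Set P4 := {p | IsGeneralOutside ∅ p}

/-- The pairs of a general parameter `p` and a plane in the set `T₁` over `p`. -/
def TropeCover : Type := {z : generalLocus × P3 // z.2 ∈ tropeSet z.1}

instance : TopologicalSpace TropeCover :=
  inferInstanceAs (TopologicalSpace {z : generalLocus × P3 // z.2 ∈ tropeSet z.1})

/-- The projection from pairs `(p, T)` to parameters `p`. -/
def tropeProj (z : TropeCover) : generalLocus := z.1.1

/-- The plane of a pair `(p, T)`. -/
def TropeCover.plane (z : TropeCover) : P3 := z.1.2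

/-! ### The group `Γ` -/

/-- `[x : y : z : w] ↦ [y : x : w : z]` -/
def lin₁ : (Fin 4 → ℂ) ≃ₗ[ℂ] (Fin 4 → ℂ) :=
  LinearEquiv.ofInvolutive
    { toFun := fun v => ![v 1, v 0, v 3, v 2]
      map_add' := fun v w => by ext i; fin_cases i <;> simp
      map_smul' := fun a v => by ext i; fin_cases i <;> simp }
    (fun v => by ext i; fin_cases i <;> simp)

/-- `[x : y : z : w] ↦ [z : w : x : y]` -/
def lin₂ : (Fin 4 → ℂ) ≃ₗ[ℂ] (Fin 4 → ℂ) :=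
  LinearEquiv.ofInvolutive
    { toFun := fun v => ![v 2, v 3, v 0, v 1]
      map_add' := fun v w => by ext i; fin_cases i <;> simp
      map_smul' := fun a v => by ext i; fin_cases i <;> simp }
    (fun v => by ext i; fin_cases i <;> simp)

/-- `[x : y : z : w] ↦ [x : y : -z : -w]` -/
def lin₃ : (Fin 4 → ℂ) ≃ₗ[ℂ] (Fin 4 → ℂ) :=
  LinearEquiv.ofInvolutive
    { toFun := fun v => ![v 0, v 1, -v 2, -v 3]
      map_add' := fun v w => by ext i; fin_cases i <;> simp [add_comm]
      map_smul' := fun a v => by ext i; fin_cases i <;> simp }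
    (fun v => by ext i; fin_cases i <;> simp)

/-- `[x : y : z : w] ↦ [x : -y : z : -w]` -/
def lin₄ : (Fin 4 → ℂ) ≃ₗ[ℂ] (Fin 4 → ℂ) :=
  LinearEquiv.ofInvolutive
    { toFun := fun v => ![v 0, -v 1, v 2, -v 3]
      map_add' := fun v w => by ext i; fin_cases i <;> simp [add_comm]
      map_smul' := fun a v => by ext i; fin_cases i <;> simp }
    (fun v => by ext i; fin_cases i <;> simp)

/-- The projective transformation induced by a linear automorphism. -/
def projPerm (g : (Fin 4 → ℂ) ≃ₗ[ℂ] (Fin 4 → ℂ)) : Equiv.Perm P3 := MulAction.toPerm g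

/-- The Heisenberg group `Γ`: the group of transformations of projective `3`-space generated by
the four involutions. It acts on planes by the same formulas in the dual coordinates. -/
def Gam : Subgroup (Equiv.Perm P3) :=
  Subgroup.closure {projPerm lin₁, projPerm lin₂, projPerm lin₃, projPerm lin₄}

/-- The generator `[x : y : z : w] ↦ [y : x : w : z]` of `Γ`. -/
def γ₁ : Gam := ⟨projPerm lin₁, Subgroup.subset_closure (by simp)⟩

/-- The generator `[x : y : z : w] ↦ [z : w : x : y]` of `Γ`. -/
def γ₂ : Gam := ⟨projPerm lin₂, Subgroup.subset_closure (by simp)⟩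

/-- The generator `[x : y : z : w] ↦ [x : y : -z : -w]` of `Γ`. -/
def γ₃ : Gam := ⟨projPerm lin₃, Subgroup.subset_closure (by simp)⟩

/-- The generator `[x : y : z : w] ↦ [x : -y : z : -w]` of `Γ`. -/
def γ₄ : Gam := ⟨projPerm lin₄, Subgroup.subset_closure (by simp)⟩

/-- The element of `Γ` by which loops around a singular hyperplane through `q₁` act on `T₁`.
The value at the six hyperplanes that do not contain `q₁` is not used. -/
def localMonodromy : SingularHyperplane → Gam
  | .qpC => γ₃
  | .qpD => γ₄
  | .qmE => γ₃ * γ₄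
  | .pp0 => γ₁ * γ₂
  | .pm0 => γ₁ * γ₂ * γ₃ * γ₄
  | .pp1 => γ₂ * γ₃ * γ₄
  | .pm1 => γ₂ * γ₃
  | .pp2 => γ₁ * γ₃ * γ₄
  | .pm2 => γ₁ * γ₄
  | _ => 1

/-! ### Loops around a hyperplane -/

/-- The loop `l` in the general locus goes (once) around the singular hyperplane `H`: up to
homotopy in the general locus it runs along a path `d` to the boundary of a small disc
`{[u + s v] : |s| ≤ 1}`, once counterclockwise around that boundary, and back along `d`.
The centre of the disc lies on `H` and on no other component of the complement of the general
locus, and the rest of the disc lies in the general locus. -/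
def IsLoopAround (H : SingularHyperplane) {p : generalLocus} (l : Path p p) : Prop :=
  ∃ (u v : Fin 5 → ℂ) (hw : ∀ s : ℂ, ‖s‖ ≤ 1 → u + s • v ≠ 0),
    H.form u = 0 ∧
    IsGeneralOutside {H} (Projectivization.mk ℂ (u + (0 : ℂ) • v) (hw 0 (by simp))) ∧
    (∀ (s : ℂ) (hs : ‖s‖ ≤ 1), s ≠ 0 → Projectivization.mk ℂ (u + s • v) (hw s hs) ∈ generalLocus) ∧
    ∃ (b : generalLocus) (c : Path b b) (d : Path p b),
      (∀ t : unitInterval, ∃ h : u + Complex.exp (2 * Real.pi * Complex.I * (t : ℝ)) • v ≠ 0,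
        (c t : P4) = Projectivization.mk ℂ _ h) ∧
      l.Homotopic (d.trans (c.trans d.symm))

end

end HeisenbergQuartic

open HeisenbergQuartic

open scoped LinearAlgebra.Projectivization Topology

namespace HeisenbergQuartic

/-! The tropes over `p` correspond to the nodes of one Kummer quartic, namely that of the residual
point `p₁`. These nodes form a free orbit of `Γ`, so `π` is a quotient covering with group `Γ`, and
only the action of loops remains to be found.

Singular points. Let `v` be a node of the quartic with coefficients `c`, where `c` is off the
singular hyperplanes. The Euler-type combinations `x∂x ± y∂y ± z∂z ± w∂w` of the partial derivatives
give three relations (`GradVanishes.relC`, `relD`, `relE`) between the diagonal quadrics `dq0`, ...,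
`dq3` at `v`. They show that `c` is proportional to an explicit vector `coeffOf v`
(`exists_eq_smul_coeffOf`), that a node exists when the Segre cubic vanishes at `c`
(`exists_gradVanishes`), and that any two nodes are related by `Γ` (`gamRel_of_gradVanishes`). An
explicit identity writes the quartic as a product of four planes minus the square of a diagonal
quadric (`quartic_coeffOf_eq`). Hence the plane dual to a node is a trope.

Projection. As `q₁` is a double point of the cubic, the residual point is a polynomial function
`residualVec` of `p`. A linear form vanishing at `q₁` takes the same value at `p` and at
`residualVec` up to the common factor `-nodeCone`. Ratios of products of the nine forms through `q₁`
can therefore be computed at `p` itself.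

Semi-invariants. Each of the functions `dq0/dq1`, `dq0/dq2`, `mqC/dq2`, `mqD/dq1` on planes is
multiplied by `±1` under `Γ`, and the four sign characters together separate the elements of `Γ`.
The forms of the nine hyperplanes factor into fundamental quadrics at `coeffOf v`, so the square of
each function on a trope is a constant times a ratio of products of two of these forms (`ratio_sq`).

Monodromy. Along a small circle around `H`, a square root of the form of `H` changes sign, and
square roots of the other forms return to their values. This gives the sign changes of the four
functions along a lifted circle (`ratio_circle`), and these identify the element of `Γ`
(`monodromy_circle`). The connecting path `d` does not matter, because monodromy commutes with the
action of `Γ`. For the same reason, and because `Γ` is abelian and simply transitive on fibres,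
every monodromy permutation comes from `Γ`. Conversely the local elements already generate `Γ`
(`range_monodromyPerm`). -/

/-! ### The singular points of the quartics -/

/-- The gradient of the quartic form with coefficients `c` vanishes at `v`. -/
structure GradVanishes (c : Fin 5 → ℂ) (v : Fin 4 → ℂ) : Prop where
  dx : 4 * c 0 * v 0 ^ 3 + c 1 * v 1 * v 2 * v 3
    + 2 * v 0 * (c 2 * v 1 ^ 2 + c 3 * v 2 ^ 2 + c 4 * v 3 ^ 2) = 0
  dy : 4 * c 0 * v 1 ^ 3 + c 1 * v 0 * v 2 * v 3
    + 2 * v 1 * (c 2 * v 0 ^ 2 + c 3 * v 3 ^ 2 + c 4 * v 2 ^ 2) = 0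
  dz : 4 * c 0 * v 2 ^ 3 + c 1 * v 0 * v 1 * v 3
    + 2 * v 2 * (c 2 * v 3 ^ 2 + c 3 * v 0 ^ 2 + c 4 * v 1 ^ 2) = 0
  dw : 4 * c 0 * v 3 ^ 3 + c 1 * v 0 * v 1 * v 2
    + 2 * v 3 * (c 2 * v 2 ^ 2 + c 3 * v 1 ^ 2 + c 4 * v 0 ^ 2) = 0

theorem gradVanishes_iff (c : Fin 5 → ℂ) (v : Fin 4 → ℂ) : GradVanishes c v ↔
    4 * c 0 * v 0 ^ 3 + c 1 * v 1 * v 2 * v 3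
      + 2 * v 0 * (c 2 * v 1 ^ 2 + c 3 * v 2 ^ 2 + c 4 * v 3 ^ 2) = 0 ∧
    4 * c 0 * v 1 ^ 3 + c 1 * v 0 * v 2 * v 3
      + 2 * v 1 * (c 2 * v 0 ^ 2 + c 3 * v 3 ^ 2 + c 4 * v 2 ^ 2) = 0 ∧
    4 * c 0 * v 2 ^ 3 + c 1 * v 0 * v 1 * v 3
      + 2 * v 2 * (c 2 * v 3 ^ 2 + c 3 * v 0 ^ 2 + c 4 * v 1 ^ 2) = 0 ∧
    4 * c 0 * v 3 ^ 3 + c 1 * v 0 * v 1 * v 2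
      + 2 * v 3 * (c 2 * v 2 ^ 2 + c 3 * v 1 ^ 2 + c 4 * v 0 ^ 2) = 0 :=
  ⟨fun ⟨h0, h1, h2, h3⟩ => ⟨h0, h1, h2, h3⟩, fun ⟨h0, h1, h2, h3⟩ => ⟨h0, h1, h2, h3⟩⟩

theorem isSingularPoint_quartic_iff (c : Fin 5 → ℂ) (T : P3) :
    IsSingularPoint (quartic c) T ↔ GradVanishes c T.rep := by
  generalize hv : T.rep = v
  have e0 : MvPolynomial.eval v (MvPolynomial.pderiv 0 (quartic c)) =
      4 * c 0 * v 0 ^ 3 + c 1 * v 1 * v 2 * v 3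
        + 2 * v 0 * (c 2 * v 1 ^ 2 + c 3 * v 2 ^ 2 + c 4 * v 3 ^ 2) := by
    simp [quartic, MvPolynomial.pderiv_X]; ring
  have e1 : MvPolynomial.eval v (MvPolynomial.pderiv 1 (quartic c)) =
      4 * c 0 * v 1 ^ 3 + c 1 * v 0 * v 2 * v 3
        + 2 * v 1 * (c 2 * v 0 ^ 2 + c 3 * v 3 ^ 2 + c 4 * v 2 ^ 2) := by
    simp [quartic, MvPolynomial.pderiv_X]; ring
  have e2 : MvPolynomial.eval v (MvPolynomial.pderiv 2 (quartic c)) =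
      4 * c 0 * v 2 ^ 3 + c 1 * v 0 * v 1 * v 3
        + 2 * v 2 * (c 2 * v 3 ^ 2 + c 3 * v 0 ^ 2 + c 4 * v 1 ^ 2) := by
    simp [quartic, MvPolynomial.pderiv_X]; ring
  have e3 : MvPolynomial.eval v (MvPolynomial.pderiv 3 (quartic c)) =
      4 * c 0 * v 3 ^ 3 + c 1 * v 0 * v 1 * v 2
        + 2 * v 3 * (c 2 * v 2 ^ 2 + c 3 * v 1 ^ 2 + c 4 * v 0 ^ 2) := by
    simp [quartic, MvPolynomial.pderiv_X]; ring
  simp only [IsSingularPoint, hv, Fin.forall_fin_succ, IsEmpty.forall_iff, and_true]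
  simp only [Fin.succ_zero_eq_one, Fin.succ_one_eq_two, show (2 : Fin 3).succ = (3 : Fin 4) from rfl,
    show (1 : Fin 2).succ = (2 : Fin 3) from rfl, e0, e1, e2, e3]
  refine ⟨fun ⟨_, h0, h1, h2, h3⟩ => ⟨h0, h1, h2, h3⟩, fun ⟨h0, h1, h2, h3⟩ => ⟨?_, h0, h1, h2, h3⟩⟩
  simp only [quartic, map_add, map_mul, map_pow, MvPolynomial.eval_X, MvPolynomial.eval_C]
  linear_combination (v 0 / 4) * h0 + (v 1 / 4) * h1 + (v 2 / 4) * h2 + (v 3 / 4) * h3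

theorem GradVanishes.smul {c : Fin 5 → ℂ} {v : Fin 4 → ℂ} (h : GradVanishes c v) (a b : ℂ) :
    GradVanishes (a • c) (b • v) := by
  constructor <;> simp only [Pi.smul_apply, smul_eq_mul]
  · linear_combination a * b ^ 3 * h.dx
  · linear_combination a * b ^ 3 * h.dy
  · linear_combination a * b ^ 3 * h.dz
  · linear_combination a * b ^ 3 * h.dw

/-! ### Fundamental quadrics -/

/-- `x² + y² + z² + w²` -/
def dq0 (v : Fin 4 → ℂ) : ℂ := v 0 ^ 2 + v 1 ^ 2 + v 2 ^ 2 + v 3 ^ 2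
/-- `x² + y² - z² - w²` -/
def dq1 (v : Fin 4 → ℂ) : ℂ := v 0 ^ 2 + v 1 ^ 2 - v 2 ^ 2 - v 3 ^ 2
/-- `x² - y² + z² - w²` -/
def dq2 (v : Fin 4 → ℂ) : ℂ := v 0 ^ 2 - v 1 ^ 2 + v 2 ^ 2 - v 3 ^ 2
/-- `x² - y² - z² + w²` -/
def dq3 (v : Fin 4 → ℂ) : ℂ := v 0 ^ 2 - v 1 ^ 2 - v 2 ^ 2 + v 3 ^ 2
/-- `xy + zw` -/
def mqC (v : Fin 4 → ℂ) : ℂ := v 0 * v 1 + v 2 * v 3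
/-- `xz + yw` -/
def mqD (v : Fin 4 → ℂ) : ℂ := v 0 * v 2 + v 1 * v 3
/-- `x²y² - z²w²` -/
def dlC (v : Fin 4 → ℂ) : ℂ := v 0 ^ 2 * v 1 ^ 2 - v 2 ^ 2 * v 3 ^ 2
/-- `x²z² - y²w²` -/
def dlD (v : Fin 4 → ℂ) : ℂ := v 0 ^ 2 * v 2 ^ 2 - v 1 ^ 2 * v 3 ^ 2
/-- `x²w² - y²z²` -/
def dlE (v : Fin 4 → ℂ) : ℂ := v 0 ^ 2 * v 3 ^ 2 - v 1 ^ 2 * v 2 ^ 2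

/-- The coefficient vector of the quartic of the family that is singular at `v`. -/
def coeffOf (v : Fin 4 → ℂ) : Fin 5 → ℂ :=
  ![dlC v * dlD v * dlE v,
    2 * (v 0 * v 1 * v 2 * v 3) * (dq0 v * dq1 v * dq2 v * dq3 v),
    -(v 0 ^ 4 + v 1 ^ 4 - v 2 ^ 4 - v 3 ^ 4) * (dlD v * dlE v),
    -(v 0 ^ 4 + v 2 ^ 4 - v 1 ^ 4 - v 3 ^ 4) * (dlC v * dlE v),
    -(v 0 ^ 4 + v 3 ^ 4 - v 1 ^ 4 - v 2 ^ 4) * (dlC v * dlD v)]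

theorem gradVanishes_coeffOf (v : Fin 4 → ℂ) : GradVanishes (coeffOf v) v := by
  constructor <;>
  · simp [coeffOf, dlC, dlD, dlE, dq0, dq1, dq2, dq3]
    ring

section

variable {c : Fin 5 → ℂ} {v : Fin 4 → ℂ}

/-- In the combination `x∂x + y∂y - z∂z - w∂w` the terms in `B`, `D` and `E` cancel. What is left is
linear in `A` and `C`, and the factors `2A ± C` separate the two products of quadrics. The relations
`relD` and `relE` arise from the other two sign patterns. -/
theorem GradVanishes.relC (h : GradVanishes c v) :
    (2 * c 0 + c 2) * (dq0 v * dq1 v) + (2 * c 0 - c 2) * (dq2 v * dq3 v) = 0 := by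
  simp only [dq0, dq1, dq2, dq3]
  linear_combination v 0 * h.dx + v 1 * h.dy - v 2 * h.dz - v 3 * h.dw

theorem GradVanishes.relD (h : GradVanishes c v) :
    (2 * c 0 + c 3) * (dq0 v * dq2 v) + (2 * c 0 - c 3) * (dq1 v * dq3 v) = 0 := by
  simp only [dq0, dq1, dq2, dq3]
  linear_combination v 0 * h.dx - v 1 * h.dy + v 2 * h.dz - v 3 * h.dw

theorem GradVanishes.relE (h : GradVanishes c v) :
    (2 * c 0 + c 4) * (dq0 v * dq3 v) + (2 * c 0 - c 4) * (dq1 v * dq2 v) = 0 := by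
  simp only [dq0, dq1, dq2, dq3]
  linear_combination v 0 * h.dx - v 1 * h.dy - v 2 * h.dz + v 3 * h.dw

/-- `c` lies on none of the fifteen singular hyperplanes. -/
def OffHyperplanes (c : Fin 5 → ℂ) : Prop := ∀ H : SingularHyperplane, H.form c ≠ 0

/-- If three of the diagonal quadrics vanish at a singular point, then the coefficient vector lies
on a singular hyperplane. -/
theorem dq_three_ne (hc : OffHyperplanes c) (h : GradVanishes c v) (hv : v ≠ 0) :
    ¬ (dq1 v = 0 ∧ dq2 v = 0 ∧ dq3 v = 0) ∧ ¬ (dq0 v = 0 ∧ dq2 v = 0 ∧ dq3 v = 0) ∧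
    ¬ (dq0 v = 0 ∧ dq1 v = 0 ∧ dq3 v = 0) ∧ ¬ (dq0 v = 0 ∧ dq1 v = 0 ∧ dq2 v = 0) := by
  have hx : v 1 ^ 2 - v 0 ^ 2 = 0 ∨ v 1 ^ 2 + v 0 ^ 2 = 0 → v 2 ^ 2 - v 0 ^ 2 = 0 ∨ v 2 ^ 2 + v 0 ^ 2 = 0 →
      v 3 ^ 2 - v 0 ^ 2 = 0 ∨ v 3 ^ 2 + v 0 ^ 2 = 0 → v 0 ≠ 0 := by
    intro h1 h2 h3 h0
    apply hv
    ext i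
    fin_cases i <;> simp_all
  refine ⟨?_, ?_, ?_, ?_⟩ <;> rintro ⟨ha, hb, hd⟩ <;> simp only [dq0, dq1, dq2, dq3] at ha hb hd
  · have e1 : v 1 ^ 2 - v 0 ^ 2 = 0 := by linear_combination -(hb + hd) / 2
    have e2 : v 2 ^ 2 - v 0 ^ 2 = 0 := by linear_combination -(ha + hd) / 2
    have e3 : v 3 ^ 2 - v 0 ^ 2 = 0 := by linear_combination -(ha + hb) / 2
    have h0 := hx (.inl e1) (.inl e2) (.inl e3)
    -- In each of the four cases the squares of `y`, `z`, `w` are `±x²` with an even number of minus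
    -- signs, so `(yzw)² = x⁶`. The sign in `yzw = ±x³` decides which of the two hyperplanes
    -- contains `c`.
    have e : (v 1 * v 2 * v 3 - v 0 ^ 3) * (v 1 * v 2 * v 3 + v 0 ^ 3) = 0 := by
      linear_combination v 2 ^ 2 * v 3 ^ 2 * e1 + v 0 ^ 2 * v 3 ^ 2 * e2 + v 0 ^ 4 * e3
    rcases mul_eq_zero.1 e with e | e
    · refine mul_ne_zero (hc .pp0) (pow_ne_zero 3 h0) ?_
      simp only [SingularHyperplane.form]
      linear_combination h.dx - c 1 * e - 2 * v 0 * (c 2 * e1 + c 3 * e2 + c 4 * e3)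
    · refine mul_ne_zero (hc .pm0) (pow_ne_zero 3 h0) ?_
      simp only [SingularHyperplane.form]
      linear_combination h.dx - c 1 * e - 2 * v 0 * (c 2 * e1 + c 3 * e2 + c 4 * e3)
  · have e1 : v 1 ^ 2 - v 0 ^ 2 = 0 := by linear_combination -(hb + hd) / 2
    have e2 : v 2 ^ 2 + v 0 ^ 2 = 0 := by linear_combination (ha + hb) / 2
    have e3 : v 3 ^ 2 + v 0 ^ 2 = 0 := by linear_combination (ha + hd) / 2
    have h0 := hx (.inl e1) (.inr e2) (.inr e3)
    have e : (v 1 * v 2 * v 3 - v 0 ^ 3) * (v 1 * v 2 * v 3 + v 0 ^ 3) = 0 := by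
      linear_combination v 2 ^ 2 * v 3 ^ 2 * e1 + v 0 ^ 2 * v 3 ^ 2 * e2 - v 0 ^ 4 * e3
    rcases mul_eq_zero.1 e with e | e
    · refine mul_ne_zero (hc .pp1) (pow_ne_zero 3 h0) ?_
      simp only [SingularHyperplane.form]
      linear_combination h.dx - c 1 * e - 2 * v 0 * (c 2 * e1 + c 3 * e2 + c 4 * e3)
    · refine mul_ne_zero (hc .pm1) (pow_ne_zero 3 h0) ?_
      simp only [SingularHyperplane.form]
      linear_combination h.dx - c 1 * e - 2 * v 0 * (c 2 * e1 + c 3 * e2 + c 4 * e3)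
  · have e1 : v 1 ^ 2 + v 0 ^ 2 = 0 := by linear_combination (ha + hb) / 2
    have e2 : v 2 ^ 2 - v 0 ^ 2 = 0 := by linear_combination -(hb + hd) / 2
    have e3 : v 3 ^ 2 + v 0 ^ 2 = 0 := by linear_combination (ha + hd) / 2
    have h0 := hx (.inr e1) (.inl e2) (.inr e3)
    have e : (v 1 * v 2 * v 3 - v 0 ^ 3) * (v 1 * v 2 * v 3 + v 0 ^ 3) = 0 := by
      linear_combination v 2 ^ 2 * v 3 ^ 2 * e1 - v 0 ^ 2 * v 3 ^ 2 * e2 - v 0 ^ 4 * e3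
    rcases mul_eq_zero.1 e with e | e
    · refine mul_ne_zero (hc .pp2) (pow_ne_zero 3 h0) ?_
      simp only [SingularHyperplane.form]
      linear_combination h.dx - c 1 * e - 2 * v 0 * (c 2 * e1 + c 3 * e2 + c 4 * e3)
    · refine mul_ne_zero (hc .pm2) (pow_ne_zero 3 h0) ?_
      simp only [SingularHyperplane.form]
      linear_combination h.dx - c 1 * e - 2 * v 0 * (c 2 * e1 + c 3 * e2 + c 4 * e3)
  · have e1 : v 1 ^ 2 + v 0 ^ 2 = 0 := by linear_combination (ha + hb) / 2
    have e2 : v 2 ^ 2 + v 0 ^ 2 = 0 := by linear_combination (ha + hd) / 2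
    have e3 : v 3 ^ 2 - v 0 ^ 2 = 0 := by linear_combination -(hb + hd) / 2
    have h0 := hx (.inr e1) (.inr e2) (.inl e3)
    have e : (v 1 * v 2 * v 3 - v 0 ^ 3) * (v 1 * v 2 * v 3 + v 0 ^ 3) = 0 := by
      linear_combination v 2 ^ 2 * v 3 ^ 2 * e1 - v 0 ^ 2 * v 3 ^ 2 * e2 + v 0 ^ 4 * e3
    rcases mul_eq_zero.1 e with e | e
    · refine mul_ne_zero (hc .pp3) (pow_ne_zero 3 h0) ?_
      simp only [SingularHyperplane.form]
      linear_combination h.dx - c 1 * e - 2 * v 0 * (c 2 * e1 + c 3 * e2 + c 4 * e3)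
    · refine mul_ne_zero (hc .pm3) (pow_ne_zero 3 h0) ?_
      simp only [SingularHyperplane.form]
      linear_combination h.dx - c 1 * e - 2 * v 0 * (c 2 * e1 + c 3 * e2 + c 4 * e3)

/-- If one of the four quadrics vanishes, each of the three relations loses one of its terms, so the
pairwise products of the other three quadrics vanish. Then at least two of those are zero as well,
which `dq_three_ne` excludes. -/
theorem dq_ne_zero (hc : OffHyperplanes c) (h : GradVanishes c v) (hv : v ≠ 0) :
    dq0 v ≠ 0 ∧ dq1 v ≠ 0 ∧ dq2 v ≠ 0 ∧ dq3 v ≠ 0 := by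
  have hqC : 2 * c 0 + c 2 ≠ 0 := hc .qpC
  have hqC' : 2 * c 0 - c 2 ≠ 0 := hc .qmC
  have hqD : 2 * c 0 + c 3 ≠ 0 := hc .qpD
  have hqD' : 2 * c 0 - c 3 ≠ 0 := hc .qmD
  have hqE : 2 * c 0 + c 4 ≠ 0 := hc .qpE
  have hqE' : 2 * c 0 - c 4 ≠ 0 := hc .qmE
  have rC := h.relC
  have rD := h.relD
  have rE := h.relE
  obtain ⟨n0, n1, n2, n3⟩ := dq_three_ne hc h hv
  refine ⟨fun e => ?_, fun e => ?_, fun e => ?_, fun e => ?_⟩ <;>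
    simp only [e, zero_mul, mul_zero, zero_add, add_zero, mul_eq_zero, hqC, hqC', hqD, hqD', hqE, hqE',
      false_or, true_and, and_true] at rC rD rE n0 n1 n2 n3 <;>
    clear hqC hqC' hqD hqD' hqE hqE' e hv h hc <;>
    generalize (dq0 v = 0) = Pdq0 at * <;> generalize (dq1 v = 0) = Pdq1 at * <;> generalize (dq2 v = 0) = Pdq2 at * <;>
    generalize (dq3 v = 0) = Pdq3 at * <;> tauto

/-- Modulo `dlC`, both `dq0 * dq1` and `dq2 * dq3` are `x⁴ + y⁴ - z⁴ - w⁴`, so `relC` reduces to `4A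
* dq0 * dq1 = 0`. The other two cases are analogous. -/
theorem dl_ne_zero (hc : OffHyperplanes c) (h : GradVanishes c v) (hv : v ≠ 0) :
    dlC v ≠ 0 ∧ dlD v ≠ 0 ∧ dlE v ≠ 0 := by
  obtain ⟨h0, h1, h2, h3⟩ := dq_ne_zero hc h hv
  have hA : c 0 ≠ 0 := hc .A
  refine ⟨fun e => ?_, fun e => ?_, fun e => ?_⟩
  · refine mul_ne_zero (mul_ne_zero h0 h1) hA ?_
    have := h.relC
    simp only [dq0, dq1, dq2, dq3, dlC] at *
    linear_combination this / 4 + (2 * c 0 - c 2) * e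
  · refine mul_ne_zero (mul_ne_zero h0 h2) hA ?_
    have := h.relD
    simp only [dq0, dq1, dq2, dq3, dlD] at *
    linear_combination this / 4 + (2 * c 0 - c 3) * e
  · refine mul_ne_zero (mul_ne_zero h0 h3) hA ?_
    have := h.relE
    simp only [dq0, dq1, dq2, dq3, dlE] at *
    linear_combination this / 4 + (2 * c 0 - c 4) * e

/-- The three relations are linear in `A, C, D, E` and give `C`, `D`, `E` as multiples of `A` with
denominators `dlC`, `dlD`, `dlE`. The coefficient `B` does not occur in them and has to be found
separately. -/
theorem exists_coeff_eq_of_rel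
    (rC : (2 * c 0 + c 2) * (dq0 v * dq1 v) + (2 * c 0 - c 2) * (dq2 v * dq3 v) = 0)
    (rD : (2 * c 0 + c 3) * (dq0 v * dq2 v) + (2 * c 0 - c 3) * (dq1 v * dq3 v) = 0)
    (rE : (2 * c 0 + c 4) * (dq0 v * dq3 v) + (2 * c 0 - c 4) * (dq1 v * dq2 v) = 0)
    (hC : dlC v ≠ 0) (hD : dlD v ≠ 0) (hE : dlE v ≠ 0) :
    ∃ k, c 0 = k * coeffOf v 0 ∧ c 2 = k * coeffOf v 2 ∧ c 3 = k * coeffOf v 3 ∧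
      c 4 = k * coeffOf v 4 := by
  have k2 : c 2 * dlC v = - c 0 * (v 0 ^ 4 + v 1 ^ 4 - v 2 ^ 4 - v 3 ^ 4) := by
    simp only [dq0, dq1, dq2, dq3, dlC] at *
    linear_combination rC / 4
  have k3 : c 3 * dlD v = - c 0 * (v 0 ^ 4 + v 2 ^ 4 - v 1 ^ 4 - v 3 ^ 4) := by
    simp only [dq0, dq1, dq2, dq3, dlD] at *
    linear_combination rD / 4
  have k4 : c 4 * dlE v = - c 0 * (v 0 ^ 4 + v 3 ^ 4 - v 1 ^ 4 - v 2 ^ 4) := by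
    simp only [dq0, dq1, dq2, dq3, dlE] at *
    linear_combination rE / 4
  obtain ⟨k, k0⟩ : ∃ k, c 0 = k * (dlC v * dlD v * dlE v) :=
    ⟨c 0 / (dlC v * dlD v * dlE v), by field_simp⟩
  refine ⟨k, k0, mul_right_cancel₀ hC ?_, mul_right_cancel₀ hD ?_, mul_right_cancel₀ hE ?_⟩ <;>
    simp only [coeffOf, Matrix.cons_val, k2, k3, k4, k0] <;> ring

theorem eq_smul_coeffOf {k : ℂ} (h0 : c 0 = k * coeffOf v 0) (h1 : c 1 = k * coeffOf v 1)
    (h2 : c 2 = k * coeffOf v 2) (h3 : c 3 = k * coeffOf v 3) (h4 : c 4 = k * coeffOf v 4) :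
    c = k • coeffOf v := by
  ext i
  fin_cases i
  exacts [h0, h1, h2, h3, h4]

/-- The coefficient vector of a quartic with a singular point `v` is determined by `v`. -/
theorem exists_eq_smul_coeffOf (hc : OffHyperplanes c) (h : GradVanishes c v) (hv : v ≠ 0) :
    ∃ k : ℂ, k ≠ 0 ∧ c = k • coeffOf v := by
  obtain ⟨hC, hD, hE⟩ := dl_ne_zero hc h hv
  obtain ⟨k, c0, c2, c3, c4⟩ := exists_coeff_eq_of_rel h.relC h.relD h.relE hC hD hE
  have hk : k ≠ 0 := fun e => hc .A (by simp [SingularHyperplane.form, c0, e])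
  refine ⟨k, hk, eq_smul_coeffOf c0 ?_ c2 c3 c4⟩
  -- The vectors `c` and `k • coeffOf v` agree except possibly in `B`, and both gradients vanish at
  -- `v`. If the values of `B` differed, all products of three coordinates would vanish, hence two
  -- coordinates would, and then `dlC v` or `dlD v` would be zero.
  obtain ⟨gx, gy, gz, gw⟩ := (gradVanishes_coeffOf v).smul k 1
  simp only [Pi.smul_apply, smul_eq_mul, ← c0, ← c2, ← c3, ← c4, one_mul] at gx gy gz gw
  generalize k * coeffOf v 1 = b at *
  have ex : (c 1 - b) * (v 1 * v 2 * v 3) = 0 := by linear_combination h.dx - gx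
  have ey : (c 1 - b) * (v 0 * v 2 * v 3) = 0 := by linear_combination h.dy - gy
  have ez : (c 1 - b) * (v 0 * v 1 * v 3) = 0 := by linear_combination h.dz - gz
  have ew : (c 1 - b) * (v 0 * v 1 * v 2) = 0 := by linear_combination h.dw - gw
  by_contra hne
  have hne : c 1 - b ≠ 0 := sub_ne_zero.2 hne
  simp only [mul_eq_zero, hne, false_or] at ex ey ez ew
  have aux : (v 0 = 0 ∧ v 1 = 0) ∨ (v 0 = 0 ∧ v 2 = 0) ∨ (v 0 = 0 ∧ v 3 = 0) ∨
    (v 1 = 0 ∧ v 2 = 0) ∨ (v 1 = 0 ∧ v 3 = 0) ∨ (v 2 = 0 ∧ v 3 = 0) := by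
    clear * - ex ey ez ew
    generalize (v 0 = 0) = P0 at *; generalize (v 1 = 0) = P1 at *
    generalize (v 2 = 0) = P2 at *; generalize (v 3 = 0) = P3 at *
    tauto
  rcases aux with ⟨a, b⟩ | ⟨a, b⟩ | ⟨a, b⟩ | ⟨a, b⟩ | ⟨a, b⟩ | ⟨a, b⟩ <;>
    simp [dlC, dlD, a, b] at hC hD

/-! ### Existence of a singular point -/

/-- A vector with prescribed values of the diagonal quadrics. -/
theorem exists_dq_eq (a₀ a₁ a₂ a₃ : ℂ) :
    ∃ v : Fin 4 → ℂ, dq0 v = a₀ ∧ dq1 v = a₁ ∧ dq2 v = a₂ ∧ dq3 v = a₃ := by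
  obtain ⟨x, hx⟩ := IsAlgClosed.exists_pow_nat_eq ((a₀ + a₁ + a₂ + a₃) / 4) two_pos
  obtain ⟨y, hy⟩ := IsAlgClosed.exists_pow_nat_eq ((a₀ + a₁ - a₂ - a₃) / 4) two_pos
  obtain ⟨z, hz⟩ := IsAlgClosed.exists_pow_nat_eq ((a₀ - a₁ + a₂ - a₃) / 4) two_pos
  obtain ⟨w, hw⟩ := IsAlgClosed.exists_pow_nat_eq ((a₀ - a₁ - a₂ + a₃) / 4) two_pos
  refine ⟨![x, y, z, w], ?_⟩
  simp only [dq0, dq1, dq2, dq3, Matrix.cons_val, hx, hy, hz, hw]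
  refine ⟨?_, ?_, ?_, ?_⟩ <;> ring

/-- The vector `coeffOf v` parametrises points of the Segre cubic. After the common factor `4 * dlC
* dlD * dlE` is removed, the identity involves only the squares of the coordinates; it is proved in
those variables to keep the degree low. -/
theorem segreCubic_coeffOf (v : Fin 4 → ℂ) : segreCubic (coeffOf v) = 0 := by
  have key : ∀ X Y Z W : ℂ,
      4 * ((X * Y - Z * W) * (X * Z - Y * W) * (X * W - Y * Z)) ^ 2
      + X * Y * Z * W * ((X + Y + Z + W) * (X + Y - Z - W) * (X - Y + Z - W) * (X - Y - Z + W)) ^ 2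
      - ((X ^ 2 + Y ^ 2 - Z ^ 2 - W ^ 2) * (X * Z - Y * W) * (X * W - Y * Z)) ^ 2
      - ((X ^ 2 + Z ^ 2 - Y ^ 2 - W ^ 2) * (X * Y - Z * W) * (X * W - Y * Z)) ^ 2
      - ((X ^ 2 + W ^ 2 - Y ^ 2 - Z ^ 2) * (X * Y - Z * W) * (X * Z - Y * W)) ^ 2
      - (X ^ 2 + Y ^ 2 - Z ^ 2 - W ^ 2) * (X ^ 2 + Z ^ 2 - Y ^ 2 - W ^ 2) *
        (X ^ 2 + W ^ 2 - Y ^ 2 - Z ^ 2) *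
        ((X * Y - Z * W) * (X * Z - Y * W) * (X * W - Y * Z)) = 0 := by
    intros; ring
  have := key (v 0 ^ 2) (v 1 ^ 2) (v 2 ^ 2) (v 3 ^ 2)
  simp only [segreCubic, coeffOf, Matrix.cons_val]
  rw [show dlC v = v 0 ^ 2 * v 1 ^ 2 - v 2 ^ 2 * v 3 ^ 2 from rfl,
    show dlD v = v 0 ^ 2 * v 2 ^ 2 - v 1 ^ 2 * v 3 ^ 2 from rfl,
    show dlE v = v 0 ^ 2 * v 3 ^ 2 - v 1 ^ 2 * v 2 ^ 2 from rfl,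
    show dq0 v = v 0 ^ 2 + v 1 ^ 2 + v 2 ^ 2 + v 3 ^ 2 from rfl,
    show dq1 v = v 0 ^ 2 + v 1 ^ 2 - v 2 ^ 2 - v 3 ^ 2 from rfl,
    show dq2 v = v 0 ^ 2 - v 1 ^ 2 + v 2 ^ 2 - v 3 ^ 2 from rfl,
    show dq3 v = v 0 ^ 2 - v 1 ^ 2 - v 2 ^ 2 + v 3 ^ 2 from rfl]
  generalize v 0 ^ 2 * v 1 ^ 2 - v 2 ^ 2 * v 3 ^ 2 = a at *
  generalize v 0 ^ 2 * v 2 ^ 2 - v 1 ^ 2 * v 3 ^ 2 = b at *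
  generalize v 0 ^ 2 * v 3 ^ 2 - v 1 ^ 2 * v 2 ^ 2 = d at *
  generalize v 0 ^ 2 + v 1 ^ 2 + v 2 ^ 2 + v 3 ^ 2 = e at *
  generalize v 0 ^ 2 + v 1 ^ 2 - v 2 ^ 2 - v 3 ^ 2 = f at *
  generalize v 0 ^ 2 - v 1 ^ 2 + v 2 ^ 2 - v 3 ^ 2 = g at *
  generalize v 0 ^ 2 - v 1 ^ 2 - v 2 ^ 2 + v 3 ^ 2 = h at *
  linear_combination (4 * a * b * d) * this

theorem segreCubic_smul (k : ℂ) (c : Fin 5 → ℂ) :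
    segreCubic (k • c) = k ^ 3 * segreCubic c := by
  simp only [segreCubic, Pi.smul_apply, smul_eq_mul]
  ring

/-- The relations are solved for the values of the diagonal quadrics, and `v` is recovered from
these by square roots. The cubic is quadratic in `B` without a linear term, so its vanishing
determines `B` up to sign, and the sign is corrected by a reflection. -/
theorem exists_gradVanishes (hc : OffHyperplanes c) (hS : segreCubic c = 0) :
    ∃ v, v ≠ 0 ∧ GradVanishes c v := by
  have hA : c 0 ≠ 0 := hc .A
  have hqC : 2 * c 0 + c 2 ≠ 0 := hc .qpC
  have hqC' : 2 * c 0 - c 2 ≠ 0 := hc .qmC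
  have hqD : 2 * c 0 + c 3 ≠ 0 := hc .qpD
  have hqD' : 2 * c 0 - c 3 ≠ 0 := hc .qmD
  have hqE : 2 * c 0 + c 4 ≠ 0 := hc .qpE
  have hqE' : 2 * c 0 - c 4 ≠ 0 := hc .qmE
  -- With `dq0 = 1`, eliminating `dq1` from the relations C, E and from C, D dictates the squares of
  -- `dq2` and `dq3`. Any choice of roots works, since `dq1` is then defined by the relation C.
  obtain ⟨a₂, ha₂⟩ := IsAlgClosed.exists_pow_nat_eq
    ((2 * c 0 + c 2) * (2 * c 0 + c 4) / ((2 * c 0 - c 2) * (2 * c 0 - c 4))) two_pos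
  obtain ⟨a₃, ha₃⟩ := IsAlgClosed.exists_pow_nat_eq
    ((2 * c 0 + c 2) * (2 * c 0 + c 3) / ((2 * c 0 - c 2) * (2 * c 0 - c 3))) two_pos
  rw [eq_div_iff (by positivity)] at ha₂ ha₃
  obtain ⟨v, q0, q1, q2, q3⟩ :=
    exists_dq_eq 1 (- ((2 * c 0 - c 2) * a₂ * a₃) / (2 * c 0 + c 2)) a₂ a₃
  have q1' : dq1 v * (2 * c 0 + c 2) = - ((2 * c 0 - c 2) * a₂ * a₃) := by
    rw [q1]; field_simp
  have rC : (2 * c 0 + c 2) * (dq0 v * dq1 v) + (2 * c 0 - c 2) * (dq2 v * dq3 v) = 0 := by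
    rw [q0, q2, q3]; linear_combination q1'
  have rD : (2 * c 0 + c 3) * (dq0 v * dq2 v) + (2 * c 0 - c 3) * (dq1 v * dq3 v) = 0 := by
    apply mul_left_cancel₀ hqC
    rw [q0, q2, q3]; linear_combination (2 * c 0 - c 3) * a₃ * q1' - a₂ * ha₃
  have rE : (2 * c 0 + c 4) * (dq0 v * dq3 v) + (2 * c 0 - c 4) * (dq1 v * dq2 v) = 0 := by
    apply mul_left_cancel₀ hqC
    rw [q0, q2, q3]; linear_combination (2 * c 0 - c 4) * a₂ * q1' - a₃ * ha₂
  have n0 : dq0 v ≠ 0 := by rw [q0]; exact one_ne_zero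
  have n2 : dq2 v ≠ 0 := by
    rw [q2]; rintro rfl; apply mul_ne_zero hqC hqE; linear_combination -ha₂
  have n3 : dq3 v ≠ 0 := by
    rw [q3]; rintro rfl; apply mul_ne_zero hqC hqD; linear_combination -ha₃
  have n1 : dq1 v ≠ 0 := by
    intro e; rw [e, zero_mul] at q1'
    exact mul_ne_zero (mul_ne_zero hqC' (q2 ▸ n2)) (q3 ▸ n3) (by linear_combination q1')
  have hv : v ≠ 0 := by rintro rfl; simp [dq0] at n0
  have hC : dlC v ≠ 0 := fun e => by
    refine mul_ne_zero (mul_ne_zero n0 n1) hA ?_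
    simp only [dq0, dq1, dq2, dq3, dlC] at *
    linear_combination rC / 4 + (2 * c 0 - c 2) * e
  have hD : dlD v ≠ 0 := fun e => by
    refine mul_ne_zero (mul_ne_zero n0 n2) hA ?_
    simp only [dq0, dq1, dq2, dq3, dlD] at *
    linear_combination rD / 4 + (2 * c 0 - c 3) * e
  have hE : dlE v ≠ 0 := fun e => by
    refine mul_ne_zero (mul_ne_zero n0 n3) hA ?_
    simp only [dq0, dq1, dq2, dq3, dlE] at *
    linear_combination rE / 4 + (2 * c 0 - c 4) * e
  obtain ⟨k, c0, c2, c3, c4⟩ := exists_coeff_eq_of_rel rC rD rE hC hD hE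
  have hk : (c 1 - k * coeffOf v 1) * (c 1 + k * coeffOf v 1) = 0 := by
    apply mul_left_cancel₀ hA
    have h := segreCubic_smul k (coeffOf v)
    rw [segreCubic_coeffOf] at h
    simp only [segreCubic, Pi.smul_apply, smul_eq_mul, ← c0, ← c2, ← c3, ← c4] at h hS
    linear_combination hS - h
  rcases mul_eq_zero.1 hk with e | e
  · refine ⟨v, hv, ?_⟩
    rw [eq_smul_coeffOf c0 (sub_eq_zero.1 e) c2 c3 c4]
    simpa using (gradVanishes_coeffOf v).smul k 1
  -- Changing the sign of one coordinate reverses `xyzw`, hence the entry `B` of `coeffOf`, and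
  -- preserves the other entries, which depend only on squares.
  · set v' : Fin 4 → ℂ := ![-v 0, v 1, v 2, v 3] with hv'
    have hb : dq0 v' = dq0 v := by simp [hv', dq0]
    refine ⟨v', fun h => n0 (by rw [← hb, h]; simp [dq0]), ?_⟩
    rw [eq_smul_coeffOf (v := v') (k := k) (c := c)]
    · simpa using (gradVanishes_coeffOf v').smul k 1
    · rw [c0]; simp [hv', coeffOf, dlC, dlD, dlE]
    · rw [eq_neg_of_add_eq_zero_left e]; simp [hv', coeffOf, dq0, dq1, dq2, dq3]
    · rw [c2]; simp [hv', coeffOf, dlD, dlE, Even.neg_pow (by decide : Even 4)]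
    · rw [c3]; simp [hv', coeffOf, dlC, dlE, Even.neg_pow (by decide : Even 4)]
    · rw [c4]; simp [hv', coeffOf, dlC, dlD, Even.neg_pow (by decide : Even 4)]

end

/-! ### The Heisenberg group -/

theorem projPerm_mk (g : (Fin 4 → ℂ) ≃ₗ[ℂ] (Fin 4 → ℂ)) {v : Fin 4 → ℂ} (hv : v ≠ 0)
    (hgv : g v ≠ 0) :
    projPerm g (Projectivization.mk ℂ v hv) = Projectivization.mk ℂ (g v) hgv := rfl

theorem projPerm_mul_self {g : (Fin 4 → ℂ) ≃ₗ[ℂ] (Fin 4 → ℂ)} (h : ∀ v, g (g v) = v) :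
    projPerm g * projPerm g = 1 := by
  ext T
  induction T using Projectivization.ind with
  | h v hv =>
    have h1 : g v ≠ 0 := g.map_ne_zero_iff.2 hv
    rw [Equiv.Perm.mul_apply, projPerm_mk g hv h1, projPerm_mk g h1 (g.map_ne_zero_iff.2 h1),
      Equiv.Perm.one_apply, Projectivization.mk_eq_mk_iff']
    exact ⟨1, by rw [one_smul, h]⟩

theorem projPerm_commute {g g' : (Fin 4 → ℂ) ≃ₗ[ℂ] (Fin 4 → ℂ)} (a : ℂ)
    (h : ∀ v, g (g' v) = a • g' (g v)) : Commute (projPerm g) (projPerm g') := by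
  ext T
  induction T using Projectivization.ind with
  | h v hv =>
    have h1 : g v ≠ 0 := g.map_ne_zero_iff.2 hv
    have h2 : g' v ≠ 0 := g'.map_ne_zero_iff.2 hv
    rw [Equiv.Perm.mul_apply, Equiv.Perm.mul_apply, projPerm_mk g hv h1, projPerm_mk g' hv h2,
      projPerm_mk g h2 (g.map_ne_zero_iff.2 h2), projPerm_mk g' h1 (g'.map_ne_zero_iff.2 h1),
      Projectivization.mk_eq_mk_iff']
    exact ⟨a, (h v).symm⟩

theorem lin₁_apply (v : Fin 4 → ℂ) : lin₁ v = ![v 1, v 0, v 3, v 2] := rfl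
theorem lin₂_apply (v : Fin 4 → ℂ) : lin₂ v = ![v 2, v 3, v 0, v 1] := rfl
theorem lin₃_apply (v : Fin 4 → ℂ) : lin₃ v = ![v 0, v 1, -v 2, -v 3] := rfl
theorem lin₄_apply (v : Fin 4 → ℂ) : lin₄ v = ![v 0, -v 1, v 2, -v 3] := rfl

/-- The linear maps that induce the generators of `Γ`. -/
noncomputable def genLin : Fin 4 → ((Fin 4 → ℂ) ≃ₗ[ℂ] (Fin 4 → ℂ)) := ![lin₁, lin₂, lin₃, lin₄]

theorem genLin_mul_self (i : Fin 4) : projPerm (genLin i) * projPerm (genLin i) = 1 := by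
  apply projPerm_mul_self
  intro v
  fin_cases i <;> ext j <;> fin_cases j <;>
    simp [genLin, lin₁_apply, lin₂_apply, lin₃_apply, lin₄_apply]

theorem genLin_commute (i j : Fin 4) : Commute (projPerm (genLin i)) (projPerm (genLin j)) := by
  have key : ∃ a : ℂ, ∀ v, genLin i (genLin j v) = a • genLin j (genLin i v) := by
    -- The linear lifts of `γ₁, γ₄` and of `γ₂, γ₃` anticommute, and all other pairs commute. The
    -- scalar `-1` disappears in projective space.
    by_cases h : (i = 0 ∧ j = 3) ∨ (i = 3 ∧ j = 0) ∨ (i = 1 ∧ j = 2) ∨ (i = 2 ∧ j = 1)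
    · refine ⟨-1, fun v => ?_⟩
      rcases h with ⟨rfl, rfl⟩ | ⟨rfl, rfl⟩ | ⟨rfl, rfl⟩ | ⟨rfl, rfl⟩ <;> ext k <;> fin_cases k <;>
        simp [genLin, lin₁_apply, lin₂_apply, lin₃_apply, lin₄_apply]
    · refine ⟨1, fun v => ?_⟩
      fin_cases i <;> fin_cases j <;> first
        | (exact absurd (by decide) h)
        | (ext k; fin_cases k <;>
            simp [genLin, lin₁_apply, lin₂_apply, lin₃_apply, lin₄_apply])
  obtain ⟨a, ha⟩ := key
  exact projPerm_commute a ha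

theorem pow_val_add {G : Type*} [Group G] {g : G} (hg : g * g = 1) (a b : ZMod 2) :
    g ^ (a + b).val = g ^ a.val * g ^ b.val := by
  rw [← pow_add, ZMod.val_add]
  conv_rhs => rw [← Nat.div_add_mod (a.val + b.val) 2, pow_add, pow_mul, pow_two, hg, one_pow,
    one_mul]

/-- The words in the four generators. -/
noncomputable def wordHom : Multiplicative (Fin 4 → ZMod 2) →* Equiv.Perm P3 where
  toFun f := projPerm lin₁ ^ (f.toAdd 0).val * projPerm lin₂ ^ (f.toAdd 1).val *
    projPerm lin₃ ^ (f.toAdd 2).val * projPerm lin₄ ^ (f.toAdd 3).val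
  map_one' := by simp
  map_mul' f g := by
    simp only [toAdd_mul, Pi.add_apply]
    rw [pow_val_add (g := projPerm lin₁) (genLin_mul_self 0),
      pow_val_add (g := projPerm lin₂) (genLin_mul_self 1),
      pow_val_add (g := projPerm lin₃) (genLin_mul_self 2),
      pow_val_add (g := projPerm lin₄) (genLin_mul_self 3)]
    have c (i j : Fin 4) (m n : ℕ) :
        Commute (projPerm (genLin i) ^ m) (projPerm (genLin j) ^ n) :=
      (genLin_commute i j).pow_pow m n
    have c1 (m n : ℕ) : Commute (projPerm lin₂ ^ m) (projPerm lin₁ ^ n) := c 1 0 m n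
    have c2 (m n k : ℕ) : Commute (projPerm lin₃ ^ m) (projPerm lin₁ ^ n * projPerm lin₂ ^ k) :=
      (c 2 0 m n).mul_right (c 2 1 m k)
    have c3 (m n k l : ℕ) : Commute (projPerm lin₄ ^ m)
        (projPerm lin₁ ^ n * projPerm lin₂ ^ k * projPerm lin₃ ^ l) :=
      ((c 3 0 m n).mul_right (c 3 1 m k)).mul_right (c 3 2 m l)
    rw [(c3 _ _ _ _).mul_mul_mul_comm, (c2 _ _ _).mul_mul_mul_comm, (c1 _ _).mul_mul_mul_comm]

theorem range_wordHom : wordHom.range = Gam := by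
  have m1 : projPerm lin₁ ∈ Gam := γ₁.2
  have m2 : projPerm lin₂ ∈ Gam := γ₂.2
  have m3 : projPerm lin₃ ∈ Gam := γ₃.2
  have m4 : projPerm lin₄ ∈ Gam := γ₄.2
  apply le_antisymm
  · rintro _ ⟨f, rfl⟩
    exact mul_mem (mul_mem (mul_mem (pow_mem m1 _) (pow_mem m2 _)) (pow_mem m3 _)) (pow_mem m4 _)
  · rw [Gam, Subgroup.closure_le]
    rintro g (rfl | rfl | rfl | rfl)
    · exact ⟨.ofAdd ![1, 0, 0, 0], by simp [wordHom, ZMod.val_one]⟩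
    · exact ⟨.ofAdd ![0, 1, 0, 0], by simp [wordHom, ZMod.val_one]⟩
    · exact ⟨.ofAdd ![0, 0, 1, 0], by simp [wordHom, ZMod.val_one]⟩
    · exact ⟨.ofAdd ![0, 0, 0, 1], by simp [wordHom, ZMod.val_one]⟩

/-! ### Semi-invariant functions -/

/-- Four semi-invariant functions, by homogeneous coordinates. -/
noncomputable def ratioVec (v : Fin 4 → ℂ) : Fin 4 → ℂ :=
  ![dq0 v / dq1 v, dq0 v / dq2 v, mqC v / dq2 v, mqD v / dq1 v]

theorem dq0_smul (a : ℂ) (v : Fin 4 → ℂ) : dq0 (a • v) = a ^ 2 * dq0 v := by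
  simp only [dq0, Pi.smul_apply, smul_eq_mul]; ring
theorem dq1_smul (a : ℂ) (v : Fin 4 → ℂ) : dq1 (a • v) = a ^ 2 * dq1 v := by
  simp only [dq1, Pi.smul_apply, smul_eq_mul]; ring
theorem dq2_smul (a : ℂ) (v : Fin 4 → ℂ) : dq2 (a • v) = a ^ 2 * dq2 v := by
  simp only [dq2, Pi.smul_apply, smul_eq_mul]; ring
theorem mqC_smul (a : ℂ) (v : Fin 4 → ℂ) : mqC (a • v) = a ^ 2 * mqC v := by
  simp only [mqC, Pi.smul_apply, smul_eq_mul]; ring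
theorem mqD_smul (a : ℂ) (v : Fin 4 → ℂ) : mqD (a • v) = a ^ 2 * mqD v := by
  simp only [mqD, Pi.smul_apply, smul_eq_mul]; ring

theorem ratioVec_smul {a : ℂ} (ha : a ≠ 0) (v : Fin 4 → ℂ) : ratioVec (a • v) = ratioVec v := by
  have := pow_ne_zero 2 ha
  simp only [ratioVec, dq0_smul, dq1_smul, dq2_smul, mqC_smul, mqD_smul,
    mul_div_mul_left _ _ this]

/-- Four functions on the space of planes that are semi-invariant under `Γ`. -/
noncomputable def ratio (T : P3) : Fin 4 → ℂ := ratioVec T.rep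

theorem ratio_mk {v : Fin 4 → ℂ} (hv : v ≠ 0) : ratio (Projectivization.mk ℂ v hv) = ratioVec v := by
  obtain ⟨a, ha⟩ := Projectivization.exists_smul_eq_mk_rep ℂ v hv
  rw [ratio, ← ha]
  exact ratioVec_smul a.ne_zero v

theorem ratio_projPerm {g : (Fin 4 → ℂ) ≃ₗ[ℂ] (Fin 4 → ℂ)} {s : Fin 4 → ℂ}
    (h : ∀ v, ratioVec (g v) = s * ratioVec v) (T : P3) :
    ratio (projPerm g T) = s * ratio T := by
  induction T using Projectivization.ind with
  | h v hv => rw [projPerm_mk g hv (g.map_ne_zero_iff.2 hv), ratio_mk, ratio_mk, h]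

theorem ratio_lin₁ (T : P3) : ratio (projPerm lin₁ T) = ![1, -1, -1, 1] * ratio T := by
  refine ratio_projPerm (fun v => ?_) T
  have e0 : dq0 (lin₁ v) = dq0 v := by simp [lin₁_apply, dq0]; ring
  have e1 : dq1 (lin₁ v) = dq1 v := by simp [lin₁_apply, dq1]; ring
  have e2 : dq2 (lin₁ v) = - dq2 v := by simp [lin₁_apply, dq2]; ring
  have eC : mqC (lin₁ v) = mqC v := by simp [lin₁_apply, mqC]; ring
  have eD : mqD (lin₁ v) = mqD v := by simp [lin₁_apply, mqD]; ring
  ext i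
  fin_cases i <;> simp [ratioVec, e0, e1, e2, eC, eD, div_neg]

theorem ratio_lin₂ (T : P3) : ratio (projPerm lin₂ T) = ![-1, 1, 1, -1] * ratio T := by
  refine ratio_projPerm (fun v => ?_) T
  have e0 : dq0 (lin₂ v) = dq0 v := by simp [lin₂_apply, dq0]; ring
  have e1 : dq1 (lin₂ v) = - dq1 v := by simp [lin₂_apply, dq1]; ring
  have e2 : dq2 (lin₂ v) = dq2 v := by simp [lin₂_apply, dq2]; ring
  have eC : mqC (lin₂ v) = mqC v := by simp [lin₂_apply, mqC]; ring
  have eD : mqD (lin₂ v) = mqD v := by simp [lin₂_apply, mqD]; ring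
  ext i
  fin_cases i <;> simp [ratioVec, e0, e1, e2, eC, eD, div_neg]

theorem ratio_lin₃ (T : P3) : ratio (projPerm lin₃ T) = ![1, 1, 1, -1] * ratio T := by
  refine ratio_projPerm (fun v => ?_) T
  have e0 : dq0 (lin₃ v) = dq0 v := by simp [lin₃_apply, dq0]
  have e1 : dq1 (lin₃ v) = dq1 v := by simp [lin₃_apply, dq1]
  have e2 : dq2 (lin₃ v) = dq2 v := by simp [lin₃_apply, dq2]
  have eC : mqC (lin₃ v) = mqC v := by simp [lin₃_apply, mqC]
  have eD : mqD (lin₃ v) = - mqD v := by simp [lin₃_apply, mqD]; ring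
  ext i
  fin_cases i <;> simp [ratioVec, e0, e1, e2, eC, eD, neg_div]

theorem ratio_lin₄ (T : P3) : ratio (projPerm lin₄ T) = ![1, 1, -1, 1] * ratio T := by
  refine ratio_projPerm (fun v => ?_) T
  have e0 : dq0 (lin₄ v) = dq0 v := by simp [lin₄_apply, dq0]
  have e1 : dq1 (lin₄ v) = dq1 v := by simp [lin₄_apply, dq1]
  have e2 : dq2 (lin₄ v) = dq2 v := by simp [lin₄_apply, dq2]
  have eC : mqC (lin₄ v) = - mqC v := by simp [lin₄_apply, mqC]; ring
  have eD : mqD (lin₄ v) = mqD v := by simp [lin₄_apply, mqD]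
  ext i
  fin_cases i <;> simp [ratioVec, e0, e1, e2, eC, eD, neg_div]

theorem ratio_pow {g : Equiv.Perm P3} {s : Fin 4 → ℂ} (h : ∀ T, ratio (g T) = s * ratio T)
    (n : ℕ) (T : P3) : ratio ((g ^ n) T) = s ^ n * ratio T := by
  induction n with
  | zero => simp
  | succ n ih => rw [pow_succ', Equiv.Perm.mul_apply, h, ih, pow_succ', mul_assoc]

/-- The sign characters are independent: the functions with index `1` and `0` detect the exponents
of `γ₁` and `γ₂`. Once these are zero, the functions with index `3` and `2` detect the exponents of
`γ₃` and `γ₄`. -/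
theorem wordHom_eq_one_of_ratio {f : Multiplicative (Fin 4 → ZMod 2)} {T : P3}
    (hT : ∀ i, ratio T i ≠ 0) (h : ratio (wordHom f T) = ratio T) : f = 1 := by
  have e : ratio (wordHom f T) = ![1, -1, -1, 1] ^ (f.toAdd 0).val * (![-1, 1, 1, -1] ^ (f.toAdd 1).val
      * (![1, 1, 1, -1] ^ (f.toAdd 2).val * (![1, 1, -1, 1] ^ (f.toAdd 3).val * ratio T))) := by
    simp only [wordHom, MonoidHom.coe_mk, OneHom.coe_mk, Equiv.Perm.mul_apply,
      ratio_pow ratio_lin₁, ratio_pow ratio_lin₂, ratio_pow ratio_lin₃, ratio_pow ratio_lin₄]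
  rw [h] at e
  have sq (a : ZMod 2) : a = 0 ∨ a = 1 := by revert a; decide
  have d (i : Fin 4) := congrFun e i
  have hT0 := hT 0; have hT1 := hT 1; have hT2 := hT 2; have hT3 := hT 3
  have d0 := d 0; have d1 := d 1; have d2 := d 2; have d3 := d 3
  simp only [Pi.mul_apply, Pi.pow_apply, Matrix.cons_val, one_pow, one_mul] at d0 d1 d2 d3
  have aux {a : ℂ} (ha : a ≠ 0) : a ≠ -a := fun e => ha (by linear_combination e / 2)
  apply Multiplicative.toAdd.injective
  rcases sq (f.toAdd 0) with h0 | h0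
  swap
  · simp [h0, ZMod.val_one] at d1; exact absurd d1 (aux hT1)
  rcases sq (f.toAdd 1) with h1 | h1
  swap
  · simp [h1, ZMod.val_one] at d0; exact absurd d0 (aux hT0)
  rcases sq (f.toAdd 2) with h2 | h2
  swap
  · simp [h1, h2, ZMod.val_one] at d3; exact absurd d3 (aux hT3)
  rcases sq (f.toAdd 3) with h3 | h3
  swap
  · simp [h0, h3, ZMod.val_one] at d2; exact absurd d2 (aux hT2)
  ext i
  fin_cases i
  exacts [h0, h1, h2, h3]

/-- The signs belong to the group element and do not depend on the point, so equality at one point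
with nonzero functions suffices. This is used both for freeness of the action and to identify
monodromy elements. -/
theorem eq_of_ratio_eq {g g' : Gam} {T : P3} (hT : ∀ i, ratio T i ≠ 0)
    (h : ratio ((g : Equiv.Perm P3) T) = ratio ((g' : Equiv.Perm P3) T)) : g = g' := by
  have m : ∀ g : Gam, ∃ f, wordHom f = g := fun g => by
    have : (g : Equiv.Perm P3) ∈ wordHom.range := by rw [range_wordHom]; exact g.2
    exact this
  have sgn : ∀ f, ∃ s : Fin 4 → ℂ, ∀ T, ratio (wordHom f T) = s * ratio T := fun f => by
    refine ⟨![1, -1, -1, 1] ^ (f.toAdd 0).val * (![-1, 1, 1, -1] ^ (f.toAdd 1).val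
      * (![1, 1, 1, -1] ^ (f.toAdd 2).val * (![1, 1, -1, 1] ^ (f.toAdd 3).val))), fun T => ?_⟩
    simp only [wordHom, MonoidHom.coe_mk, OneHom.coe_mk, Equiv.Perm.mul_apply,
      ratio_pow ratio_lin₁, ratio_pow ratio_lin₂, ratio_pow ratio_lin₃, ratio_pow ratio_lin₄,
      mul_assoc]
  obtain ⟨f, hf⟩ := m g
  obtain ⟨f', hf'⟩ := m g'
  have hff : f'⁻¹ * f = 1 := by
    apply wordHom_eq_one_of_ratio hT
    obtain ⟨s, hs⟩ := sgn f'⁻¹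
    rw [map_mul, Equiv.Perm.mul_apply, hs, hf, h, ← hf', ← hs, ← Equiv.Perm.mul_apply, ← map_mul,
      inv_mul_cancel, map_one, Equiv.Perm.one_apply]
  rw [inv_mul_eq_one] at hff
  exact Subtype.ext (by rw [← hf, ← hf', hff])

theorem exists_ratio_ne_zero : ∃ T : P3, ∀ i, ratio T i ≠ 0 := by
  have hv : (![1, 2, 3, 5] : Fin 4 → ℂ) ≠ 0 := fun h => by simpa using congrFun h 0
  refine ⟨Projectivization.mk ℂ _ hv, fun i => ?_⟩
  rw [ratio_mk]
  fin_cases i <;> simp [ratioVec, dq0, dq1, dq2, mqC, mqD] <;> norm_num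

theorem wordHom_injective : Function.Injective wordHom := by
  obtain ⟨T, hT⟩ := exists_ratio_ne_zero
  rw [injective_iff_map_eq_one]
  intro f hf
  exact wordHom_eq_one_of_ratio hT (by rw [hf, Equiv.Perm.one_apply])

/-- `Γ` is an elementary abelian group of order `16`. -/
noncomputable def gamEquiv : Gam ≃* Multiplicative (Fin 4 → ZMod 2) :=
  ((MonoidHom.ofInjective wordHom_injective).trans (MulEquiv.subgroupCongr range_wordHom)).symm

theorem gam_mul_comm (g h : Gam) : g * h = h * g :=
  gamEquiv.injective (by rw [map_mul, map_mul, mul_comm])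

theorem card_gam : Nat.card Gam = 16 := by
  rw [Nat.card_congr gamEquiv.toEquiv, Nat.card_congr Multiplicative.toAdd]
  simp

/-! ### The singular points of one quartic form an orbit -/

/-- The points with homogeneous coordinates `v` and `w` lie in one orbit of `Γ`. -/
def GamRel (v w : Fin 4 → ℂ) : Prop :=
  ∃ (hv : v ≠ 0) (hw : w ≠ 0), ∃ g ∈ Gam,
    g (Projectivization.mk ℂ v hv) = Projectivization.mk ℂ w hw

theorem GamRel.trans {u v w : Fin 4 → ℂ} (h : GamRel u v) (h' : GamRel v w) : GamRel u w := by
  obtain ⟨hu, hv, g, hg, e⟩ := h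
  obtain ⟨_, hw, g', hg', e'⟩ := h'
  exact ⟨hu, hw, g' * g, mul_mem hg' hg, by rw [Equiv.Perm.mul_apply, e, e']⟩

theorem gamRel_smul {v : Fin 4 → ℂ} (hv : v ≠ 0) {a : ℂ} (ha : a ≠ 0) : GamRel v (a • v) :=
  ⟨hv, smul_ne_zero ha hv, 1, one_mem _, by
    rw [Equiv.Perm.one_apply, eq_comm, Projectivization.mk_eq_mk_iff']; exact ⟨a, rfl⟩⟩

theorem gamRel_lin {v : Fin 4 → ℂ} (hv : v ≠ 0) {g : (Fin 4 → ℂ) ≃ₗ[ℂ] (Fin 4 → ℂ)}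
    (hg : projPerm g ∈ Gam) : GamRel v (g v) :=
  ⟨hv, g.map_ne_zero_iff.2 hv, projPerm g, hg, rfl⟩

/-- The eight even sign changes are `1, γ₃, γ₄, γ₃γ₄` up to an overall sign. -/
theorem gamRel_of_signs {v w s : Fin 4 → ℂ} (hv : v ≠ 0) (hs : ∀ i, s i = 1 ∨ s i = -1)
    (hp : s 0 * s 1 * s 2 * s 3 = 1) (h : ∀ i, w i = s i * v i) : GamRel v w := by
  have h3 : GamRel v (lin₃ v) := gamRel_lin hv γ₃.2
  have h4 : GamRel v (lin₄ v) := gamRel_lin hv γ₄.2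
  have h34 : GamRel v (lin₄ (lin₃ v)) :=
    h3.trans (gamRel_lin (lin₃.map_ne_zero_iff.2 hv) γ₄.2)
  have h1 : GamRel v v := by simpa using gamRel_smul hv one_ne_zero
  have neg {u : Fin 4 → ℂ} (hu : GamRel v u) : GamRel v ((-1 : ℂ) • u) :=
    hu.trans (gamRel_smul hu.choose_spec.choose (by norm_num))
  have hw : w = fun i => s i * v i := funext h
  rcases hs 0 with e0 | e0 <;> rcases hs 1 with e1 | e1 <;> rcases hs 2 with e2 | e2 <;>
    rcases hs 3 with e3 | e3 <;> rw [e0, e1, e2, e3] at hp <;> first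
    | (convert h1 using 1; rw [hw]; ext i; fin_cases i <;> simp [e0, e1, e2, e3]; done)
    | (convert h3 using 1; rw [hw]; ext i; fin_cases i <;> simp [e0, e1, e2, e3, lin₃_apply]; done)
    | (convert h4 using 1; rw [hw]; ext i; fin_cases i <;> simp [e0, e1, e2, e3, lin₄_apply]; done)
    | (convert h34 using 1; rw [hw]; ext i
       fin_cases i <;> simp [e0, e1, e2, e3, lin₄_apply, lin₃_apply]; done)
    | (convert neg h1 using 1; rw [hw]; ext i; fin_cases i <;> simp [e0, e1, e2, e3]; done)
    | (convert neg h3 using 1; rw [hw]; ext i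
       fin_cases i <;> simp [e0, e1, e2, e3, lin₃_apply]; done)
    | (convert neg h4 using 1; rw [hw]; ext i
       fin_cases i <;> simp [e0, e1, e2, e3, lin₄_apply]; done)
    | (convert neg h34 using 1; rw [hw]; ext i
       fin_cases i <;> simp [e0, e1, e2, e3, lin₄_apply, lin₃_apply]; done)
    | (norm_num at hp)

section

variable {c : Fin 5 → ℂ} {v w : Fin 4 → ℂ}

/-- The diagonal quadrics determine the squares of the coordinates, so `w` differs from `v` by sign
changes. Even ones lie in `Γ`; an odd one must be made even by means of a vanishing coordinate, or
else excluded. -/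
theorem gamRel_of_dq_eq (hc : OffHyperplanes c) (hv : v ≠ 0) (gv : GradVanishes c v)
    (gw : GradVanishes c w) (h0 : dq0 w = dq0 v) (h1 : dq1 w = dq1 v) (h2 : dq2 w = dq2 v)
    (h3 : dq3 w = dq3 v) : GamRel v w := by
  have hq0 := (dq_ne_zero hc gv hv).1
  simp only [dq0, dq1, dq2, dq3] at h0 h1 h2 h3
  have s0 : w 0 ^ 2 = v 0 ^ 2 := by linear_combination (h0 + h1 + h2 + h3) / 4
  have s1 : w 1 ^ 2 = v 1 ^ 2 := by linear_combination (h0 + h1 - h2 - h3) / 4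
  have s2 : w 2 ^ 2 = v 2 ^ 2 := by linear_combination (h0 - h1 + h2 - h3) / 4
  have s3 : w 3 ^ 2 = v 3 ^ 2 := by linear_combination (h0 - h1 - h2 + h3) / 4
  have ex : ∀ i, ∃ s : ℂ, (s = 1 ∨ s = -1) ∧ w i = s * v i := fun i => by
    have : w i ^ 2 = v i ^ 2 := by fin_cases i <;> assumption
    rcases sq_eq_sq_iff_eq_or_eq_neg.1 this with e | e
    · exact ⟨1, .inl rfl, by rw [e, one_mul]⟩
    · exact ⟨-1, .inr rfl, by rw [e, neg_one_mul]⟩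
  choose s hs hw using ex
  have hp : s 0 * s 1 * s 2 * s 3 = 1 ∨ s 0 * s 1 * s 2 * s 3 = -1 := by
    rcases hs 0 with e0 | e0 <;> rcases hs 1 with e1 | e1 <;> rcases hs 2 with e2 | e2 <;>
      rcases hs 3 with e3 | e3 <;> rw [e0, e1, e2, e3] <;> norm_num
  rcases hp with hp | hp
  · exact gamRel_of_signs hv hs hp hw
  -- Apart from the term `Bxyzw`, `x∂x` of the quartic depends only on squares of coordinates. Its
  -- vanishing at both `v` and `w`, where `xyzw` has opposite signs, isolates that term.
  have hB : c 1 * (v 0 * v 1 * v 2 * v 3) = 0 := by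
    have ew : w 0 * w 1 * w 2 * w 3 = -(v 0 * v 1 * v 2 * v 3) := by
      rw [hw 0, hw 1, hw 2, hw 3]; linear_combination (v 0 * v 1 * v 2 * v 3) * hp
    have e4 : w 0 ^ 4 = v 0 ^ 4 := by linear_combination (w 0 ^ 2 + v 0 ^ 2) * s0
    have := gw.dx
    linear_combination (v 0 / 2) * gv.dx - (w 0 / 2) * gw.dx + c 1 / 2 * ew + 2 * c 0 * e4
      + w 0 ^ 2 * (c 2 * s1 + c 3 * s2 + c 4 * s3)
      + (c 2 * v 1 ^ 2 + c 3 * v 2 ^ 2 + c 4 * v 3 ^ 2) * s0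
  -- The sign of a vanishing coordinate is arbitrary and can be used to correct the parity. If no
  -- coordinate vanishes, then `B = 0`, and the sum of the partial derivatives, each divided by its
  -- coordinate, is `p₊₀ * dq0`, which is nonzero.
  by_cases hz : ∃ i, v i = 0
  · obtain ⟨i, hi⟩ := hz
    refine gamRel_of_signs (s := Function.update s i (-s i)) hv (fun j => ?_) ?_ (fun j => ?_)
    · by_cases hj : j = i
      · subst hj; rw [Function.update_self, neg_eq_iff_eq_neg, neg_inj]; exact (hs j).symm
      · rw [Function.update_of_ne hj]; exact hs j
    · fin_cases i <;> simp [Function.update] <;> linear_combination -hp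
    · by_cases hj : j = i
      · subst hj; rw [hw, hi]; simp
      · rw [Function.update_of_ne hj, hw]
  · exfalso
    push Not at hz
    have hb : c 1 = 0 := (mul_eq_zero.1 hB).resolve_right
      (mul_ne_zero (mul_ne_zero (mul_ne_zero (hz 0) (hz 1)) (hz 2)) (hz 3))
    have ex : 2 * c 0 * v 0 ^ 2 + c 2 * v 1 ^ 2 + c 3 * v 2 ^ 2 + c 4 * v 3 ^ 2 = 0 :=
      mul_left_cancel₀ (hz 0) (by linear_combination gv.dx / 2 - v 1 * v 2 * v 3 / 2 * hb)
    have ey : 2 * c 0 * v 1 ^ 2 + c 2 * v 0 ^ 2 + c 3 * v 3 ^ 2 + c 4 * v 2 ^ 2 = 0 :=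
      mul_left_cancel₀ (hz 1) (by linear_combination gv.dy / 2 - v 0 * v 2 * v 3 / 2 * hb)
    have ez : 2 * c 0 * v 2 ^ 2 + c 2 * v 3 ^ 2 + c 3 * v 0 ^ 2 + c 4 * v 1 ^ 2 = 0 :=
      mul_left_cancel₀ (hz 2) (by linear_combination gv.dz / 2 - v 0 * v 1 * v 3 / 2 * hb)
    have e3 : 2 * c 0 * v 3 ^ 2 + c 2 * v 2 ^ 2 + c 3 * v 1 ^ 2 + c 4 * v 0 ^ 2 = 0 :=
      mul_left_cancel₀ (hz 3) (by linear_combination gv.dw / 2 - v 0 * v 1 * v 2 / 2 * hb)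
    refine mul_ne_zero (hc .pp0) hq0 ?_
    simp only [SingularHyperplane.form, dq0]
    linear_combination 2 * (ex + ey + ez + e3) +
      (v 0 ^ 2 + v 1 ^ 2 + v 2 ^ 2 + v 3 ^ 2) * hb

theorem GradVanishes.lin₁ (h : GradVanishes c v) : GradVanishes c (lin₁ v) := by
  constructor <;> simp only [lin₁_apply, Matrix.cons_val]
  · linear_combination h.dy
  · linear_combination h.dx
  · linear_combination h.dw
  · linear_combination h.dz

theorem GradVanishes.lin₂ (h : GradVanishes c v) : GradVanishes c (lin₂ v) := by
  constructor <;> simp only [lin₂_apply, Matrix.cons_val]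
  · linear_combination h.dz
  · linear_combination h.dw
  · linear_combination h.dx
  · linear_combination h.dy

theorem GradVanishes.lin₃ (h : GradVanishes c v) : GradVanishes c (lin₃ v) := by
  constructor <;> simp only [lin₃_apply, Matrix.cons_val]
  · linear_combination h.dx
  · linear_combination h.dy
  · linear_combination -h.dz
  · linear_combination -h.dw

theorem GradVanishes.lin₄ (h : GradVanishes c v) : GradVanishes c (lin₄ v) := by
  constructor <;> simp only [lin₄_apply, Matrix.cons_val]
  · linear_combination h.dx
  · linear_combination -h.dy
  · linear_combination h.dz
  · linear_combination -h.dw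

/-- Two singular points of a quartic off the singular hyperplanes lie in one orbit of `Γ`. -/
theorem gamRel_of_gradVanishes (hc : OffHyperplanes c) (hv : v ≠ 0) (hw : w ≠ 0)
    (gv : GradVanishes c v) (gw : GradVanishes c w) : GamRel v w := by
  obtain ⟨n0, n1, n2, n3⟩ := dq_ne_zero hc gw hw
  -- Homogeneous coordinates of the first point are rescaled so that `dq0` agrees at both points.
  -- The relations then fix `dq2²` and `dq3²`, and `dq1` in terms of the product `dq2 * dq3`.
  obtain ⟨b, hb⟩ := IsAlgClosed.exists_pow_nat_eq (dq0 w / dq0 v) two_pos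
  have hv0 := (dq_ne_zero hc gv hv).1
  have hb0 : b ≠ 0 := by
    rintro rfl
    rw [zero_pow two_ne_zero, eq_comm, div_eq_zero_iff] at hb
    tauto
  refine (gamRel_smul hv hb0).trans ?_
  have h0 : dq0 w = dq0 (b • v) := by rw [dq0_smul, hb]; field_simp
  have gv' : GradVanishes c (b • v) := by simpa using gv.smul 1 b
  have hv' : b • v ≠ 0 := smul_ne_zero hb0 hv
  generalize b • v = u at *
  clear hb hb0 hv0 gv hv b
  have hqC : 2 * c 0 + c 2 ≠ 0 := hc .qpC
  have hqC' : 2 * c 0 - c 2 ≠ 0 := hc .qmC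
  have hqD : 2 * c 0 + c 3 ≠ 0 := hc .qpD
  have hqD' : 2 * c 0 - c 3 ≠ 0 := hc .qmD
  have hqE : 2 * c 0 + c 4 ≠ 0 := hc .qpE
  have hqE' : 2 * c 0 - c 4 ≠ 0 := hc .qmE
  have sq3 {x : Fin 4 → ℂ} (hx : x ≠ 0) (g : GradVanishes c x) :
      (2 * c 0 - c 2) * (2 * c 0 - c 3) * dq3 x ^ 2 =
        (2 * c 0 + c 2) * (2 * c 0 + c 3) * dq0 x ^ 2 := by
    obtain ⟨m0, m1, m2, m3⟩ := dq_ne_zero hc g hx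
    apply mul_left_cancel₀ (mul_ne_zero m1 m2)
    linear_combination (2 * c 0 - c 3) * dq1 x * dq3 x * g.relC -
      (2 * c 0 + c 2) * (dq0 x * dq1 x) * g.relD
  have sq2 {x : Fin 4 → ℂ} (hx : x ≠ 0) (g : GradVanishes c x) :
      (2 * c 0 - c 2) * (2 * c 0 - c 4) * dq2 x ^ 2 =
        (2 * c 0 + c 2) * (2 * c 0 + c 4) * dq0 x ^ 2 := by
    obtain ⟨m0, m1, m2, m3⟩ := dq_ne_zero hc g hx
    apply mul_left_cancel₀ (mul_ne_zero m1 m3)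
    linear_combination (2 * c 0 - c 4) * dq1 x * dq2 x * g.relC -
      (2 * c 0 + c 2) * (dq0 x * dq1 x) * g.relE
  have e3 : dq3 w ^ 2 = dq3 u ^ 2 := by
    apply mul_left_cancel₀ (mul_ne_zero hqC' hqD')
    rw [sq3 hw gw, sq3 hv' gv', h0]
  have e2 : dq2 w ^ 2 = dq2 u ^ 2 := by
    apply mul_left_cancel₀ (mul_ne_zero hqC' hqE')
    rw [sq2 hw gw, sq2 hv' gv', h0]
  have e1 : dq1 w * (dq2 u * dq3 u) = dq1 u * (dq2 w * dq3 w) := by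
    apply mul_left_cancel₀ (mul_ne_zero hqC' n0)
    linear_combination (dq0 w * dq1 w) * gv'.relC - (dq0 w * dq1 u) * gw.relC
      + (2 * c 0 + c 2) * dq0 w * dq1 w * dq1 u * h0
  obtain ⟨m0, m1, m2, m3⟩ := dq_ne_zero hc gv' hv'
  have hl1 : lin₁ u ≠ 0 := lin₁.map_ne_zero_iff.2 hv'
  have hl2 : lin₂ u ≠ 0 := lin₂.map_ne_zero_iff.2 hv'
  have hl12 : lin₂ (lin₁ u) ≠ 0 := lin₂.map_ne_zero_iff.2 hl1
  -- The four remaining sign patterns of `(dq1, dq2, dq3)` have product `+1` and are realised by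
  -- `1`, `γ₂`, `γ₁γ₂` and `γ₁`.
  rcases sq_eq_sq_iff_eq_or_eq_neg.1 e2 with f2 | f2 <;>
    rcases sq_eq_sq_iff_eq_or_eq_neg.1 e3 with f3 | f3 <;> rw [f2, f3] at e1
  · exact gamRel_of_dq_eq hc hv' gv' gw h0 (mul_right_cancel₀ (mul_ne_zero m2 m3) e1) f2 f3
  · have f1 : dq1 w = - dq1 u :=
      mul_right_cancel₀ (mul_ne_zero m2 m3) (by rw [e1]; ring)
    refine (gamRel_lin hv' γ₂.2).trans (gamRel_of_dq_eq hc hl2 gv'.lin₂ gw ?_ ?_ ?_ ?_)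
    · rw [h0]; simp [dq0, lin₂_apply]; ring
    · rw [f1]; simp [dq1, lin₂_apply]; ring
    · rw [f2]; simp [dq2, lin₂_apply]; ring
    · rw [f3]; simp [dq3, lin₂_apply]; ring
  · have f1 : dq1 w = - dq1 u :=
      mul_right_cancel₀ (mul_ne_zero m2 m3) (by rw [e1]; ring)
    refine ((gamRel_lin hv' γ₁.2).trans (gamRel_lin hl1 γ₂.2)).trans
      (gamRel_of_dq_eq hc hl12 gv'.lin₁.lin₂ gw ?_ ?_ ?_ ?_)
    · rw [h0]; simp [dq0, lin₂_apply, lin₁_apply]; ring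
    · rw [f1]; simp [dq1, lin₂_apply, lin₁_apply]; ring
    · rw [f2]; simp [dq2, lin₂_apply, lin₁_apply]; ring
    · rw [f3]; simp [dq3, lin₂_apply, lin₁_apply]; ring
  · have f1 : dq1 w = dq1 u :=
      mul_right_cancel₀ (mul_ne_zero m2 m3) (by rw [e1]; ring)
    refine (gamRel_lin hv' γ₁.2).trans (gamRel_of_dq_eq hc hl1 gv'.lin₁ gw ?_ ?_ ?_ ?_)
    · rw [h0]; simp [dq0, lin₁_apply]; ring
    · rw [f1]; simp [dq1, lin₁_apply]; ring
    · rw [f2]; simp [dq2, lin₁_apply]; ring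
    · rw [f3]; simp [dq3, lin₁_apply]; ring

end

/-! ### Singular hyperplanes and semi-invariant functions -/

theorem form_smul (H : SingularHyperplane) (a : ℂ) (c : Fin 5 → ℂ) :
    H.form (a • c) = a * H.form c := by
  cases H <;> simp only [SingularHyperplane.form, Pi.smul_apply, smul_eq_mul] <;> ring

theorem form_add (H : SingularHyperplane) (c d : Fin 5 → ℂ) :
    H.form (c + d) = H.form c + H.form d := by
  cases H <;> simp only [SingularHyperplane.form, Pi.add_apply] <;> ring

/-- On the parametrised cubic each of the nine forms through the node splits into fundamental
quadrics, here and in the next two lemmas. Suitable products of two forms then differ by the square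
of a quotient of quadrics, and this dictates the choice of `ratioVec`, `sqNum` and `sqDen`. -/
theorem form_coeffOf (v : Fin 4 → ℂ) :
    SingularHyperplane.qpC.form (coeffOf v) = -(dq2 v * dq3 v * dlD v * dlE v) ∧
    SingularHyperplane.qpD.form (coeffOf v) = -(dq1 v * dq3 v * dlC v * dlE v) ∧
    SingularHyperplane.qmE.form (coeffOf v) = dq0 v * dq3 v * dlC v * dlD v := by
  simp only [SingularHyperplane.form, coeffOf, Matrix.cons_val]
  refine ⟨?_, ?_, ?_⟩
  · have : 2 * dlC v - (v 0 ^ 4 + v 1 ^ 4 - v 2 ^ 4 - v 3 ^ 4) = -(dq2 v * dq3 v) := by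
      simp only [dlC, dq2, dq3]; ring
    linear_combination dlD v * dlE v * this
  · have : 2 * dlD v - (v 0 ^ 4 + v 2 ^ 4 - v 1 ^ 4 - v 3 ^ 4) = -(dq1 v * dq3 v) := by
      simp only [dlD, dq1, dq3]; ring
    linear_combination dlC v * dlE v * this
  · have : 2 * dlE v + (v 0 ^ 4 + v 3 ^ 4 - v 1 ^ 4 - v 2 ^ 4) = dq0 v * dq3 v := by
      simp only [dlE, dq0, dq3]; ring
    linear_combination dlC v * dlD v * this

theorem form_pp_coeffOf (v : Fin 4 → ℂ) :
    SingularHyperplane.pp0.form (coeffOf v) = 2 * dq1 v * dq2 v * dq3 v *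
      ((v 0 * v 1 - v 2 * v 3) * (v 0 * v 2 - v 1 * v 3) * (v 0 * v 3 - v 1 * v 2)) ∧
    SingularHyperplane.pp1.form (coeffOf v) = 2 * dq0 v * dq2 v * dq3 v *
      ((v 0 * v 1 - v 2 * v 3) * (v 0 * v 2 + v 1 * v 3) * (v 0 * v 3 + v 1 * v 2)) ∧
    SingularHyperplane.pp2.form (coeffOf v) = 2 * dq0 v * dq1 v * dq3 v *
      ((v 0 * v 1 + v 2 * v 3) * (v 0 * v 2 - v 1 * v 3) * (v 0 * v 3 + v 1 * v 2)) := by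
  simp only [SingularHyperplane.form, coeffOf, Matrix.cons_val, dlC, dlD, dlE, dq0, dq1, dq2, dq3]
  refine ⟨?_, ?_, ?_⟩ <;> ring

theorem form_pm_coeffOf (v : Fin 4 → ℂ) :
    SingularHyperplane.pm0.form (coeffOf v) = -2 * dq1 v * dq2 v * dq3 v *
      ((v 0 * v 1 + v 2 * v 3) * (v 0 * v 2 + v 1 * v 3) * (v 0 * v 3 + v 1 * v 2)) ∧
    SingularHyperplane.pm1.form (coeffOf v) = -2 * dq0 v * dq2 v * dq3 v *
      ((v 0 * v 1 + v 2 * v 3) * (v 0 * v 2 - v 1 * v 3) * (v 0 * v 3 - v 1 * v 2)) ∧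
    SingularHyperplane.pm2.form (coeffOf v) = -2 * dq0 v * dq1 v * dq3 v *
      ((v 0 * v 1 - v 2 * v 3) * (v 0 * v 2 + v 1 * v 3) * (v 0 * v 3 - v 1 * v 2)) := by
  simp only [SingularHyperplane.form, coeffOf, Matrix.cons_val, dlC, dlD, dlE, dq0, dq1, dq2, dq3]
  refine ⟨?_, ?_, ?_⟩ <;> ring

section

variable {c : Fin 5 → ℂ} {v : Fin 4 → ℂ}

theorem mq_ne_zero (hc : OffHyperplanes c) (h : GradVanishes c v) (hv : v ≠ 0) :
    mqC v ≠ 0 ∧ mqD v ≠ 0 := by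
  obtain ⟨hC, hD, -⟩ := dl_ne_zero hc h hv
  refine ⟨fun e => hC ?_, fun e => hD ?_⟩
  · simp only [mqC, dlC] at *; linear_combination (v 0 * v 1 - v 2 * v 3) * e
  · simp only [mqD, dlD] at *; linear_combination (v 0 * v 2 - v 1 * v 3) * e

theorem ratio_ne_zero (hc : OffHyperplanes c) {T : P3} (h : GradVanishes c T.rep) (i : Fin 4) :
    ratio T i ≠ 0 := by
  obtain ⟨h0, h1, h2, h3⟩ := dq_ne_zero hc h T.rep_nonzero
  obtain ⟨hC, hD⟩ := mq_ne_zero hc h T.rep_nonzero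
  fin_cases i <;> simp [ratio, ratioVec, *]

/-- The numerators of the squares of the semi-invariant functions, as products of linear forms. -/
noncomputable def sqNum : Fin 4 → SingularHyperplane × SingularHyperplane :=
  ![(.pp1, .pm1), (.pp2, .pm2), (.qpD, .qmE), (.qpC, .qmE)]

/-- The denominators of the squares of the semi-invariant functions, as products of linear forms. -/
noncomputable def sqDen : Fin 4 → SingularHyperplane × SingularHyperplane :=
  ![(.pp0, .pm0), (.pp0, .pm0), (.pp0, .pp1), (.pp0, .pp2)]

/-- Constant factors in the squares of the semi-invariant functions. -/
noncomputable def sqConst : Fin 4 → ℂ := ![1, 1, -4, -4]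

/-- After `c` is replaced by a multiple of `coeffOf` at the node, the factorisations of the forms
turn the claim into an identity between products of quadrics. -/
theorem ratio_sq (hc : OffHyperplanes c) {T : P3} (h : GradVanishes c T.rep) (i : Fin 4) :
    ratio T i ^ 2 * ((sqDen i).1.form c * (sqDen i).2.form c) =
      sqConst i * ((sqNum i).1.form c * (sqNum i).2.form c) := by
  obtain ⟨h0, h1, h2, h3⟩ := dq_ne_zero hc h T.rep_nonzero
  obtain ⟨k, hk, e⟩ := exists_eq_smul_coeffOf hc h T.rep_nonzero
  generalize hv : T.rep = v at *
  obtain ⟨fC, fD, fE⟩ := form_coeffOf v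
  obtain ⟨p0, p1, p2⟩ := form_pp_coeffOf v
  obtain ⟨m0, m1, m2⟩ := form_pm_coeffOf v
  rw [e]
  simp only [form_smul]
  fin_cases i <;> simp only [sqDen, sqNum, sqConst, ratio, ratioVec, hv, Fin.zero_eta, Fin.mk_one,
    Fin.reduceFinMk, Matrix.cons_val, div_pow, fC, fD, fE, p0, p1, p2, m0, m1, m2, mqC, mqD,
    dlC, dlD, dlE] <;> field_simp <;> ring

/-! ### Tropes -/

/-- The first coefficient of the quadric that cuts out the conic in a trope. -/
def conicCoeff (X Y Z W : ℂ) : ℂ := X ^ 3 - X * (Y ^ 2 + Z ^ 2 + W ^ 2) + 2 * Y * Z * W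

/-- The coefficients of the quadric that cuts out the conic in a trope. -/
def conicVec (v : Fin 4 → ℂ) : Fin 4 → ℂ :=
  ![conicCoeff (v 0 ^ 2) (v 1 ^ 2) (v 2 ^ 2) (v 3 ^ 2),
    conicCoeff (v 1 ^ 2) (v 0 ^ 2) (v 2 ^ 2) (v 3 ^ 2),
    conicCoeff (v 2 ^ 2) (v 0 ^ 2) (v 1 ^ 2) (v 3 ^ 2),
    conicCoeff (v 3 ^ 2) (v 0 ^ 2) (v 1 ^ 2) (v 2 ^ 2)]

/-- The quadric `Σ αᵢ xᵢ²`. -/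
noncomputable def diagForm (a : Fin 4 → ℂ) : MvPolynomial (Fin 4) ℂ :=
  ∑ i, MvPolynomial.C (a i) * MvPolynomial.X i ^ 2

/-- The linear form `Σ vᵢ xᵢ`. -/
noncomputable def linForm (v : Fin 4 → ℂ) : MvPolynomial (Fin 4) ℂ :=
  ∑ i, MvPolynomial.C (v i) * MvPolynomial.X i

/-- With `aᵢ = vᵢxᵢ`, the product of the four linear forms is `Σ aᵢ⁴ - 2 Σ aᵢ²aⱼ² + 8 a₀a₁a₂a₃`. Its
last term accounts for `B`, and the even terms are matched coefficient by coefficient with those of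
the square of a diagonal quadric. On the plane `v` the quartic is therefore a square up to a scalar.
-/
theorem quartic_coeffOf_eq (v : Fin 4 → ℂ) :
    quartic (coeffOf v) + MvPolynomial.C (1 / 4) * diagForm (conicVec v) ^ 2 =
      MvPolynomial.C (dq0 v * dq1 v * dq2 v * dq3 v / 4) *
        (linForm v * linForm (lin₃ v) * linForm (lin₄ v) * linForm (lin₄ (lin₃ v))) := by
  set Q := dq0 v * dq1 v * dq2 v * dq3 v with hQ
  obtain ⟨X, hX⟩ : ∃ X, X = v 0 ^ 2 := ⟨_, rfl⟩
  obtain ⟨Y, hY⟩ : ∃ X, X = v 1 ^ 2 := ⟨_, rfl⟩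
  obtain ⟨Z, hZ⟩ : ∃ X, X = v 2 ^ 2 := ⟨_, rfl⟩
  obtain ⟨W, hW⟩ : ∃ X, X = v 3 ^ 2 := ⟨_, rfl⟩
  have hQ' : Q = (X + Y + Z + W) * (X + Y - Z - W) * (X - Y + Z - W) * (X - Y - Z + W) := by
    rw [hQ, hX, hY, hZ, hW]; rfl
  have e0 : coeffOf v 0 = (X * Y - Z * W) * (X * Z - Y * W) * (X * W - Y * Z) := by
    rw [hX, hY, hZ, hW]; rfl
  have e1 : coeffOf v 1 = 2 * (v 0 * v 1 * v 2 * v 3) * Q := rfl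
  have e2 : coeffOf v 2 = -(X ^ 2 + Y ^ 2 - Z ^ 2 - W ^ 2) *
      ((X * Z - Y * W) * (X * W - Y * Z)) := by
    rw [hX, hY, hZ, hW]; simp only [coeffOf, dlD, dlE, Matrix.cons_val]; ring
  have e3 : coeffOf v 3 = -(X ^ 2 + Z ^ 2 - Y ^ 2 - W ^ 2) *
      ((X * Y - Z * W) * (X * W - Y * Z)) := by
    rw [hX, hY, hZ, hW]; simp only [coeffOf, dlC, dlE, Matrix.cons_val]; ring
  have e4 : coeffOf v 4 = -(X ^ 2 + W ^ 2 - Y ^ 2 - Z ^ 2) *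
      ((X * Y - Z * W) * (X * Z - Y * W)) := by
    rw [hX, hY, hZ, hW]; simp only [coeffOf, dlC, dlD, Matrix.cons_val]; ring
  have ha : conicVec v = ![conicCoeff X Y Z W, conicCoeff Y X Z W, conicCoeff Z X Y W,
    conicCoeff W X Y Z] := by rw [hX, hY, hZ, hW]; rfl
  have q0 : coeffOf v 0 + conicVec v 0 ^ 2 / 4 = Q / 4 * X ^ 2 := by
    rw [e0, hQ', ha]; simp only [conicCoeff, Matrix.cons_val]; ring
  have q1 : coeffOf v 0 + conicVec v 1 ^ 2 / 4 = Q / 4 * Y ^ 2 := by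
    rw [e0, hQ', ha]; simp only [conicCoeff, Matrix.cons_val]; ring
  have q2 : coeffOf v 0 + conicVec v 2 ^ 2 / 4 = Q / 4 * Z ^ 2 := by
    rw [e0, hQ', ha]; simp only [conicCoeff, Matrix.cons_val]; ring
  have q3 : coeffOf v 0 + conicVec v 3 ^ 2 / 4 = Q / 4 * W ^ 2 := by
    rw [e0, hQ', ha]; simp only [conicCoeff, Matrix.cons_val]; ring
  have r01 : coeffOf v 2 + conicVec v 0 * conicVec v 1 / 2 = - (Q / 2) * (X * Y) := by
    rw [e2, hQ', ha]; simp only [conicCoeff, Matrix.cons_val]; ring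
  have r23 : coeffOf v 2 + conicVec v 2 * conicVec v 3 / 2 = - (Q / 2) * (Z * W) := by
    rw [e2, hQ', ha]; simp only [conicCoeff, Matrix.cons_val]; ring
  have r02 : coeffOf v 3 + conicVec v 0 * conicVec v 2 / 2 = - (Q / 2) * (X * Z) := by
    rw [e3, hQ', ha]; simp only [conicCoeff, Matrix.cons_val]; ring
  have r13 : coeffOf v 3 + conicVec v 1 * conicVec v 3 / 2 = - (Q / 2) * (Y * W) := by
    rw [e3, hQ', ha]; simp only [conicCoeff, Matrix.cons_val]; ring
  have r03 : coeffOf v 4 + conicVec v 0 * conicVec v 3 / 2 = - (Q / 2) * (X * W) := by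
    rw [e4, hQ', ha]; simp only [conicCoeff, Matrix.cons_val]; ring
  have r12 : coeffOf v 4 + conicVec v 1 * conicVec v 2 / 2 = - (Q / 2) * (Y * Z) := by
    rw [e4, hQ', ha]; simp only [conicCoeff, Matrix.cons_val]; ring
  clear_value Q
  clear e0 e2 e3 e4 ha hQ hQ'
  subst hX hY hZ hW
  simp only [quartic, diagForm, linForm, Fin.sum_univ_four, lin₃_apply, lin₄_apply, Matrix.cons_val]
  generalize coeffOf v = c at *
  generalize conicVec v = a at *
  apply MvPolynomial.funext
  intro x
  simp only [map_add, map_mul, map_pow, MvPolynomial.eval_C, MvPolynomial.eval_X]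
  linear_combination x 0 ^ 4 * q0 + x 1 ^ 4 * q1 + x 2 ^ 4 * q2 + x 3 ^ 4 * q3
    + x 0 ^ 2 * x 1 ^ 2 * r01 + x 2 ^ 2 * x 3 ^ 2 * r23 + x 0 ^ 2 * x 2 ^ 2 * r02
    + x 1 ^ 2 * x 3 ^ 2 * r13 + x 0 ^ 2 * x 3 ^ 2 * r03 + x 1 ^ 2 * x 2 ^ 2 * r12
    + x 0 * x 1 * x 2 * x 3 * e1

/-- The value of the dual conic. -/
theorem conicVec_dual (v : Fin 4 → ℂ) :
    v 0 ^ 2 * (conicVec v 1 * conicVec v 2 * conicVec v 3) +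
    v 1 ^ 2 * (conicVec v 0 * conicVec v 2 * conicVec v 3) +
    v 2 ^ 2 * (conicVec v 0 * conicVec v 1 * conicVec v 3) +
    v 3 ^ 2 * (conicVec v 0 * conicVec v 1 * conicVec v 2) =
    2 * (dlC v * dlD v * dlE v) * (dq0 v * dq1 v * dq2 v * dq3 v) := by
  simp only [conicVec, conicCoeff, Matrix.cons_val, dlC, dlD, dlE, dq0, dq1, dq2, dq3]
  generalize v 0 ^ 2 = X
  generalize v 1 ^ 2 = Y
  generalize v 2 ^ 2 = Z
  generalize v 3 ^ 2 = W
  ring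

theorem planeForm_eq (T : P3) : planeForm T = linForm T.rep := rfl

theorem eval_linForm (v x : Fin 4 → ℂ) : MvPolynomial.eval x (linForm v) = ∑ i, v i * x i := by
  simp [linForm]

theorem eval_diagForm (a x : Fin 4 → ℂ) :
    MvPolynomial.eval x (diagForm a) = ∑ i, a i * x i ^ 2 := by
  simp [diagForm]

theorem isHomogeneous_diagForm (a : Fin 4 → ℂ) : (diagForm a).IsHomogeneous 2 := by
  refine MvPolynomial.IsHomogeneous.sum _ _ _ fun i _ => ?_
  simpa using (MvPolynomial.isHomogeneous_C (Fin 4) (a i)).mul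
    ((MvPolynomial.isHomogeneous_X ℂ i).pow 2)

/-- A form of degree one is linear. -/
theorem exists_eq_linForm {M : MvPolynomial (Fin 4) ℂ} (hM : M.IsHomogeneous 1) :
    ∃ m : Fin 4 → ℂ, M = linForm m := by
  have h : ∀ i, ∃ a, MvPolynomial.pderiv i M = MvPolynomial.C a := fun i =>
    ⟨_, MvPolynomial.totalDegree_eq_zero_iff_eq_C.1
      ((MvPolynomial.totalDegree_zero_iff_isHomogeneous _).2 (hM.pderiv (i := i)))⟩
  choose m hm using h
  refine ⟨m, ?_⟩
  have := hM.sum_X_mul_pderiv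
  rw [one_smul] at this
  rw [← this, linForm]
  exact Finset.sum_congr rfl fun i _ => by rw [hm, mul_comm]

/-- The conic cut out in a plane by a diagonal quadric is irreducible if its dual does not vanish
at the plane. -/
theorem diagForm_irreducible {a v : Fin 4 → ℂ}
    (h : v 0 ^ 2 * (a 1 * a 2 * a 3) + v 1 ^ 2 * (a 0 * a 2 * a 3) + v 2 ^ 2 * (a 0 * a 1 * a 3) +
      v 3 ^ 2 * (a 0 * a 1 * a 2) ≠ 0) {M N : MvPolynomial (Fin 4) ℂ} (hM : M.IsHomogeneous 1)
    (hN : N.IsHomogeneous 1) : ¬ linForm v ∣ diagForm a - M * N := by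
  rintro ⟨R, hR⟩
  obtain ⟨m, rfl⟩ := exists_eq_linForm hM
  obtain ⟨n, rfl⟩ := exists_eq_linForm hN
  have hq : ∀ y : Fin 4 → ℂ, ∑ i, v i * y i = 0 →
      ∑ i, a i * y i ^ 2 = (∑ i, m i * y i) * ∑ i, n i * y i := fun y hy => by
    have := congrArg (MvPolynomial.eval y) hR
    rw [map_sub, map_mul, map_mul, eval_linForm, eval_linForm, eval_linForm, eval_diagForm, hy,
      zero_mul] at this
    exact sub_eq_zero.1 this
  -- Three linear forms in four variables have a common zero `u ≠ 0`. If the conic splits as `M * N`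
  -- on the plane, `u` is a singular point of it.
  obtain ⟨u, hu, hu0⟩ := Submodule.exists_mem_ne_zero_of_ne_bot
    (LinearMap.ker_ne_bot_of_finrank_lt (f := Matrix.mulVecLin (Matrix.of ![v, m, n])) (by simp))
  rw [LinearMap.mem_ker, Matrix.mulVecLin_apply] at hu
  have hv : ∑ i, v i * u i = 0 := congrFun hu 0
  have hm : ∑ i, m i * u i = 0 := congrFun hu 1
  have hn : ∑ i, n i * u i = 0 := congrFun hu 2
  simp only [Fin.sum_univ_four] at hq hv hm hn
  -- Polarisation with `u ± y`: the product `M * N` takes equal values at the two points, so `u` is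
  -- orthogonal to the whole plane with respect to the diagonal quadric.
  have orth : ∀ y : Fin 4 → ℂ, v 0 * y 0 + v 1 * y 1 + v 2 * y 2 + v 3 * y 3 = 0 →
      a 0 * u 0 * y 0 + a 1 * u 1 * y 1 + a 2 * u 2 * y 2 + a 3 * u 3 * y 3 = 0 := fun y hy => by
    have e1 := hq (u + y) (by simp only [Pi.add_apply]; linear_combination hv + hy)
    have e2 := hq (u - y) (by simp only [Pi.sub_apply]; linear_combination hv - hy)
    simp only [Pi.add_apply, Pi.sub_apply] at e1 e2
    linear_combination (e1 - e2) / 4 + (m 0 * y 0 + m 1 * y 1 + m 2 * y 2 + m 3 * y 3) / 2 * hn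
      + (n 0 * y 0 + n 1 * y 1 + n 2 * y 2 + n 3 * y 3) / 2 * hm
  -- These test vectors lie in the plane and show that the vector `(aᵢuᵢ)` is proportional to `v`.
  -- The dual form, being written without division by the `aᵢ`, then gives `aᵢuᵢ = 0` and `u = 0`
  -- even if some `aᵢ` vanishes.
  have o01 := orth ![v 1, -v 0, 0, 0] (by simp; ring)
  have o02 := orth ![v 2, 0, -v 0, 0] (by simp; ring)
  have o03 := orth ![v 3, 0, 0, -v 0] (by simp; ring)
  have o12 := orth ![0, v 2, -v 1, 0] (by simp; ring)
  have o13 := orth ![0, v 3, 0, -v 1] (by simp; ring)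
  have o23 := orth ![0, 0, v 3, -v 2] (by simp; ring)
  simp only [Matrix.cons_val, mul_zero, add_zero, zero_add] at o01 o02 o03 o12 o13 o23
  have z0 : a 0 * u 0 = 0 := mul_left_cancel₀ h (by
    linear_combination v 0 * (a 0 * a 1 * a 2 * a 3) * hv + v 1 * (a 0 * a 2 * a 3) * o01
      + v 2 * (a 0 * a 1 * a 3) * o02 + v 3 * (a 0 * a 1 * a 2) * o03)
  have z1 : a 1 * u 1 = 0 := mul_left_cancel₀ h (by
    linear_combination v 1 * (a 0 * a 1 * a 2 * a 3) * hv - v 0 * (a 1 * a 2 * a 3) * o01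
      + v 2 * (a 0 * a 1 * a 3) * o12 + v 3 * (a 0 * a 1 * a 2) * o13)
  have z2 : a 2 * u 2 = 0 := mul_left_cancel₀ h (by
    linear_combination v 2 * (a 0 * a 1 * a 2 * a 3) * hv - v 0 * (a 1 * a 2 * a 3) * o02
      - v 1 * (a 0 * a 2 * a 3) * o12 + v 3 * (a 0 * a 1 * a 2) * o23)
  have z3 : a 3 * u 3 = 0 := mul_left_cancel₀ h (by
    linear_combination v 3 * (a 0 * a 1 * a 2 * a 3) * hv - v 0 * (a 1 * a 2 * a 3) * o03
      - v 1 * (a 0 * a 2 * a 3) * o13 - v 2 * (a 0 * a 1 * a 3) * o23)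
  apply hu0
  ext i
  apply mul_left_cancel₀ h
  fin_cases i <;> simp only [Fin.zero_eta, Fin.mk_one, Fin.reduceFinMk, Pi.zero_apply, mul_zero]
  · linear_combination v 0 * (a 1 * a 2 * a 3) * hv
      + (v 1 ^ 2 * a 2 * a 3 + v 2 ^ 2 * a 1 * a 3 + v 3 ^ 2 * a 1 * a 2) * z0
      - v 0 * v 1 * a 2 * a 3 * z1 - v 0 * v 2 * a 1 * a 3 * z2 - v 0 * v 3 * a 1 * a 2 * z3
  · linear_combination v 1 * (a 0 * a 2 * a 3) * hv
      + (v 0 ^ 2 * a 2 * a 3 + v 2 ^ 2 * a 0 * a 3 + v 3 ^ 2 * a 0 * a 2) * z1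
      - v 1 * v 0 * a 2 * a 3 * z0 - v 1 * v 2 * a 0 * a 3 * z2 - v 1 * v 3 * a 0 * a 2 * z3
  · linear_combination v 2 * (a 0 * a 1 * a 3) * hv
      + (v 0 ^ 2 * a 1 * a 3 + v 1 ^ 2 * a 0 * a 3 + v 3 ^ 2 * a 0 * a 1) * z2
      - v 2 * v 0 * a 1 * a 3 * z0 - v 2 * v 1 * a 0 * a 3 * z1 - v 2 * v 3 * a 0 * a 1 * z3
  · linear_combination v 3 * (a 0 * a 1 * a 2) * hv
      + (v 0 ^ 2 * a 1 * a 2 + v 1 ^ 2 * a 0 * a 2 + v 2 ^ 2 * a 0 * a 1) * z3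
      - v 3 * v 0 * a 1 * a 2 * z0 - v 3 * v 1 * a 0 * a 2 * z1 - v 3 * v 2 * a 0 * a 1 * z2

theorem isTrope_of_gradVanishes (hc : OffHyperplanes c) {T : P3} (h : GradVanishes c T.rep) :
    IsTrope (quartic c) T := by
  obtain ⟨k, hk, e⟩ := exists_eq_smul_coeffOf hc h T.rep_nonzero
  obtain ⟨hC, hD, hE⟩ := dl_ne_zero hc h T.rep_nonzero
  obtain ⟨h0, h1, h2, h3⟩ := dq_ne_zero hc h T.rep_nonzero
  rw [IsTrope, planeForm_eq]
  generalize T.rep = v at *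
  -- The scalar `-k/4`, by which the square in `quartic_coeffOf_eq` enters the quartic of `c`, is
  -- absorbed into the quadric.
  obtain ⟨b, hb⟩ := IsAlgClosed.exists_pow_nat_eq (-k / 4) two_pos
  have hb0 : b ≠ 0 := by rintro rfl; apply hk; linear_combination 4 * hb
  refine ⟨diagForm (b • conicVec v), isHomogeneous_diagForm _, ?_, fun M N hM hN => ?_⟩
  · have e1 : quartic c = MvPolynomial.C k * quartic (coeffOf v) := by
      rw [e]; simp only [quartic, Pi.smul_apply, smul_eq_mul, map_mul]; ring
    have e2 : diagForm (b • conicVec v) = MvPolynomial.C b * diagForm (conicVec v) := by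
      simp [diagForm, Finset.mul_sum, mul_assoc]
    have e3 : (MvPolynomial.C b : MvPolynomial (Fin 4) ℂ) ^ 2 =
        - (MvPolynomial.C k * MvPolynomial.C (1 / 4)) := by
      rw [← map_pow, hb, ← map_mul, ← map_neg]; congr 1; ring
    refine ⟨MvPolynomial.C k * (MvPolynomial.C (dq0 v * dq1 v * dq2 v * dq3 v / 4) *
      (linForm (lin₃ v) * linForm (lin₄ v) * linForm (lin₄ (lin₃ v)))), ?_⟩
    rw [e1, e2, mul_pow, e3]
    linear_combination MvPolynomial.C k * quartic_coeffOf_eq v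
  · apply diagForm_irreducible ?_ hM hN
    have := conicVec_dual v
    simp only [Pi.smul_apply, smul_eq_mul]
    intro e
    have h' : b ^ 3 * (2 * (dlC v * dlD v * dlE v) * (dq0 v * dq1 v * dq2 v * dq3 v)) ≠ 0 := by
      simp [hb0, hC, hD, hE, h0, h1, h2, h3]
    apply h'
    rw [← this, ← e]
    ring

end

/-! ### Projection from the node -/

/-- The tangent cone of the Segre cubic at the node. -/
def nodeCone (c : Fin 5 → ℂ) : ℂ :=
  48 * c 0 ^ 2 + c 1 ^ 2 - 4 * (c 2 ^ 2 + c 3 ^ 2 + c 4 ^ 2) + 16 * c 0 * (c 2 + c 3 - c 4)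
    + 8 * (c 2 * c 3 - c 2 * c 4 - c 3 * c 4)

/-- The node is a double point, so the cubic restricted to a line through it has the factor `t²`,
and the remaining linear factor gives the third intersection. Off the cubic that point differs from
the node exactly when `nodeCone c ≠ 0`. -/
theorem segreCubic_node_add (s t : ℂ) (c : Fin 5 → ℂ) :
    segreCubic (s • nodeVec + t • c) = t ^ 2 * (s * nodeCone c + t * segreCubic c) := by
  simp only [segreCubic, nodeCone, nodeVec, Pi.add_apply, Pi.smul_apply, smul_eq_mul,
    Matrix.cons_val]
  ring

theorem nodeCone_smul (k : ℂ) (c : Fin 5 → ℂ) : nodeCone (k • c) = k ^ 2 * nodeCone c := by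
  simp only [nodeCone, Pi.smul_apply, smul_eq_mul]; ring

/-- Homogeneous coordinates of the residual point. -/
noncomputable def residualVec (c : Fin 5 → ℂ) : Fin 5 → ℂ :=
  segreCubic c • nodeVec + (-nodeCone c) • c

theorem segreCubic_residualVec (c : Fin 5 → ℂ) : segreCubic (residualVec c) = 0 := by
  rw [residualVec, segreCubic_node_add]; ring

theorem residualVec_smul (k : ℂ) (c : Fin 5 → ℂ) : residualVec (k • c) = k ^ 3 • residualVec c := by
  rw [residualVec, residualVec, segreCubic_smul, nodeCone_smul]
  module

/-- Otherwise `c` would be a multiple of the node vector and would lie on the cubic. -/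
theorem residualVec_ne_smul_node {c : Fin 5 → ℂ} (hS : segreCubic c ≠ 0) (hQ : nodeCone c ≠ 0)
    (a : ℂ) : residualVec c ≠ a • nodeVec := fun h => by
  have h1 : (-nodeCone c) • c = (a - segreCubic c) • nodeVec + (0 : ℂ) • c := by
    rw [sub_smul, ← h, residualVec]; module
  have h2 := congrArg segreCubic h1
  rw [segreCubic_smul, segreCubic_node_add] at h2
  refine mul_ne_zero (pow_ne_zero 3 (neg_ne_zero.2 hQ)) hS (by linear_combination h2)

theorem residualVec_ne_zero {c : Fin 5 → ℂ} (hS : segreCubic c ≠ 0) (hQ : nodeCone c ≠ 0) :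
    residualVec c ≠ 0 := by
  simpa using residualVec_ne_smul_node hS hQ 0

theorem form_residualVec {H : SingularHyperplane} (hH : H.form nodeVec = 0) (c : Fin 5 → ℂ) :
    H.form (residualVec c) = -nodeCone c * H.form c := by
  rw [residualVec, form_add, form_smul, form_smul, hH, mul_zero, zero_add]

/-- A point of the Segre cubic off the singular hyperplanes through the node is off all the
singular hyperplanes. -/
theorem offHyperplanes_of_segreCubic {c : Fin 5 → ℂ} (hS : segreCubic c = 0)
    (h : ∀ H : SingularHyperplane, H.form nodeVec = 0 → H.form c ≠ 0) : OffHyperplanes c := by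
  have qC : 2 * c 0 + c 2 ≠ 0 := h .qpC (by simp [SingularHyperplane.form, nodeVec])
  have qD : 2 * c 0 + c 3 ≠ 0 := h .qpD (by simp [SingularHyperplane.form, nodeVec])
  have qE : 2 * c 0 - c 4 ≠ 0 := h .qmE (by simp [SingularHyperplane.form, nodeVec])
  have p0 := h .pp0 (by simp [SingularHyperplane.form, nodeVec]; norm_num)
  have m0 := h .pm0 (by simp [SingularHyperplane.form, nodeVec]; norm_num)
  have p1 := h .pp1 (by simp [SingularHyperplane.form, nodeVec]; norm_num)
  have m1 := h .pm1 (by simp [SingularHyperplane.form, nodeVec]; norm_num)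
  have p2 := h .pp2 (by simp [SingularHyperplane.form, nodeVec]; norm_num)
  have m2 := h .pm2 (by simp [SingularHyperplane.form, nodeVec]; norm_num)
  simp only [segreCubic] at hS
  -- For `A = 0` the cubic reduces to `4CDE`, and the three forms through the node reduce to `C`,
  -- `D`, `-E`.
  have hA : c 0 ≠ 0 := fun e => by
    rw [e] at qC qD qE hS
    simp only [mul_zero, zero_add, zero_sub, neg_ne_zero] at qC qD qE
    exact mul_ne_zero (mul_ne_zero qC qD) qE (by linear_combination hS / 4)
  -- The equation of the cubic can be written in four ways as `A * p₊ᵢ * p₋ᵢ = 4 * q * q * q`. They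
  -- pass the nonvanishing from the nine hyperplanes through the node to the remaining ones.
  have s0 : c 0 * (SingularHyperplane.pp0.form c * SingularHyperplane.pm0.form c) =
      4 * (2 * c 0 + c 2) * (2 * c 0 + c 3) * (2 * c 0 + c 4) := by
    simp only [SingularHyperplane.form]; linear_combination -hS
  have s1 : c 0 * (SingularHyperplane.pp1.form c * SingularHyperplane.pm1.form c) =
      4 * (2 * c 0 + c 2) * (2 * c 0 - c 3) * (2 * c 0 - c 4) := by
    simp only [SingularHyperplane.form]; linear_combination -hS
  have s2 : c 0 * (SingularHyperplane.pp2.form c * SingularHyperplane.pm2.form c) =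
      4 * (2 * c 0 - c 2) * (2 * c 0 + c 3) * (2 * c 0 - c 4) := by
    simp only [SingularHyperplane.form]; linear_combination -hS
  have s3 : c 0 * (SingularHyperplane.pp3.form c * SingularHyperplane.pm3.form c) =
      4 * (2 * c 0 - c 2) * (2 * c 0 - c 3) * (2 * c 0 + c 4) := by
    simp only [SingularHyperplane.form]; linear_combination -hS
  have qE' : 2 * c 0 + c 4 ≠ 0 := fun e => by
    rw [e, mul_zero] at s0; exact mul_ne_zero hA (mul_ne_zero p0 m0) s0
  have qD' : 2 * c 0 - c 3 ≠ 0 := fun e => by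
    rw [e, mul_zero, zero_mul] at s1; exact mul_ne_zero hA (mul_ne_zero p1 m1) s1
  have qC' : 2 * c 0 - c 2 ≠ 0 := fun e => by
    rw [e, mul_zero, zero_mul, zero_mul] at s2; exact mul_ne_zero hA (mul_ne_zero p2 m2) s2
  have s3' : SingularHyperplane.pp3.form c * SingularHyperplane.pm3.form c ≠ 0 := fun e => by
    rw [e, mul_zero] at s3
    exact mul_ne_zero (mul_ne_zero (mul_ne_zero (by norm_num) qC') qD') qE' s3.symm
  intro H
  cases H
  exacts [hA, qC, qC', qD, qD', qE', qE, p0, p1, p2, left_ne_zero_of_mul s3', m0, m1, m2,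
    right_ne_zero_of_mul s3']

/-- The conditions on homogeneous coordinates that define the points that are general outside
`S`. -/
structure GeneralVec (S : Set SingularHyperplane) (c : Fin 5 → ℂ) : Prop where
  segre : segreCubic c ≠ 0
  form : ∀ H ∉ S, H.form c ≠ 0
  cone : nodeCone c ≠ 0

theorem GeneralVec.ne_zero {S : Set SingularHyperplane} {c : Fin 5 → ℂ} (h : GeneralVec S c) :
    c ≠ 0 := by
  rintro rfl; exact h.segre (by simp [segreCubic])

theorem generalVec_smul_iff {S : Set SingularHyperplane} {k : ℂ} (hk : k ≠ 0) (c : Fin 5 → ℂ) :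
    GeneralVec S (k • c) ↔ GeneralVec S c := by
  refine ⟨fun h => ⟨?_, fun H hH => ?_, ?_⟩, fun h => ⟨?_, fun H hH => ?_, ?_⟩⟩
  · have := h.segre; rw [segreCubic_smul] at this; exact right_ne_zero_of_mul this
  · have := h.form H hH; rw [form_smul] at this; exact right_ne_zero_of_mul this
  · have := h.cone; rw [nodeCone_smul] at this; exact right_ne_zero_of_mul this
  · rw [segreCubic_smul]; exact mul_ne_zero (pow_ne_zero 3 hk) h.segre
  · rw [form_smul]; exact mul_ne_zero hk (h.form H hH)
  · rw [nodeCone_smul]; exact mul_ne_zero (pow_ne_zero 2 hk) h.cone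

theorem GeneralVec.offHyperplanes {c : Fin 5 → ℂ} (h : GeneralVec ∅ c) :
    OffHyperplanes (residualVec c) :=
  offHyperplanes_of_segreCubic (segreCubic_residualVec c) fun H hH => by
    rw [form_residualVec hH]
    exact mul_ne_zero (neg_ne_zero.2 h.cone) (h.form H (Set.notMem_empty H))

theorem exists_smul_rep {n : ℕ} {v : Fin n → ℂ} (hv : v ≠ 0) :
    ∃ a : ℂ, a ≠ 0 ∧ (Projectivization.mk ℂ v hv).rep = a • v := by
  obtain ⟨a, ha⟩ := Projectivization.exists_smul_eq_mk_rep ℂ v hv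
  exact ⟨a, a.ne_zero, ha.symm⟩

/-- The residual point has homogeneous coordinates `residualVec c`. -/
theorem IsResidualPoint.exists_rep_eq {c : Fin 5 → ℂ} (hc : c ≠ 0) (hS : segreCubic c ≠ 0)
    {p₁ : P4} (h : IsResidualPoint (Projectivization.mk ℂ c hc) p₁) :
    nodeCone c ≠ 0 ∧ ∃ k : ℂ, k ≠ 0 ∧ p₁.rep = k • residualVec c := by
  obtain ⟨h1, h2, h3⟩ := h
  have hm : p₁.rep ∈ p₁.submodule := by
    rw [Projectivization.submodule_eq]; exact Submodule.mem_span_singleton_self _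
  have := h3 hm
  rw [node, Projectivization.submodule_mk, Projectivization.submodule_mk, Submodule.mem_sup] at this
  obtain ⟨x, hx, y, hy, e⟩ := this
  obtain ⟨s, rfl⟩ := Submodule.mem_span_singleton.1 hx
  obtain ⟨t, rfl⟩ := Submodule.mem_span_singleton.1 hy
  have ht : t ≠ 0 := by
    rintro rfl
    apply h1
    rw [zero_smul, add_zero] at e
    rw [← Projectivization.mk_rep p₁, node, Projectivization.mk_eq_mk_iff']
    exact ⟨s, e⟩
  rw [← e, segreCubic_node_add] at h2
  have h4 : s * nodeCone c + t * segreCubic c = 0 :=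
    (mul_eq_zero.1 h2).resolve_left (pow_ne_zero 2 ht)
  have hQ : nodeCone c ≠ 0 := fun hQ => by
    rw [hQ, mul_zero, zero_add] at h4
    exact mul_ne_zero ht hS h4
  refine ⟨hQ, -t / nodeCone c, div_ne_zero (neg_ne_zero.2 ht) hQ, ?_⟩
  have hs : s = -t / nodeCone c * segreCubic c := by
    field_simp; linear_combination h4
  have ht' : t = -t / nodeCone c * (- nodeCone c) := by field_simp
  rw [← e, residualVec, smul_add, smul_smul, smul_smul, ← hs, ← ht']

theorem isResidualPoint_mk {c : Fin 5 → ℂ} (hc : c ≠ 0) (hS : segreCubic c ≠ 0)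
    (hQ : nodeCone c ≠ 0) : IsResidualPoint (Projectivization.mk ℂ c hc)
      (Projectivization.mk ℂ (residualVec c) (residualVec_ne_zero hS hQ)) := by
  refine ⟨fun h => ?_, ?_, ?_⟩
  · rw [node, Projectivization.mk_eq_mk_iff'] at h
    obtain ⟨a, ha⟩ := h
    exact residualVec_ne_smul_node hS hQ a ha.symm
  · obtain ⟨a, -, ha⟩ := exists_smul_rep (residualVec_ne_zero hS hQ)
    rw [ha, segreCubic_smul, segreCubic_residualVec, mul_zero]
  · rw [node, Projectivization.submodule_mk, Projectivization.submodule_mk,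
      Projectivization.submodule_mk, Submodule.span_singleton_le_iff_mem, Submodule.mem_sup]
    exact ⟨_, Submodule.smul_mem _ _ (Submodule.mem_span_singleton_self _), _,
      Submodule.smul_mem _ _ (Submodule.mem_span_singleton_self _), rfl⟩

theorem isGeneralOutside_mk_iff {S : Set SingularHyperplane} {c : Fin 5 → ℂ} (hc : c ≠ 0) :
    IsGeneralOutside S (Projectivization.mk ℂ c hc) ↔ GeneralVec S c := by
  obtain ⟨a, ha, e⟩ := exists_smul_rep hc
  constructor
  · rintro ⟨h1, h2, p₁, h3⟩
    rw [e, segreCubic_smul] at h1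
    have hS := right_ne_zero_of_mul h1
    refine ⟨hS, fun H hH => ?_, (h3.exists_rep_eq hc hS).1⟩
    have := h2 H hH
    rw [e, form_smul] at this
    exact right_ne_zero_of_mul this
  · intro h
    have h' := (generalVec_smul_iff ha c).2 h
    rw [← e] at h'
    exact ⟨h'.segre, h'.form, _, isResidualPoint_mk hc h.segre h.cone⟩

theorem mk_mem_generalLocus_iff {c : Fin 5 → ℂ} (hc : c ≠ 0) :
    Projectivization.mk ℂ c hc ∈ generalLocus ↔ GeneralVec ∅ c :=
  isGeneralOutside_mk_iff hc

theorem generalVec_rep {p : P4} (hp : p ∈ generalLocus) : GeneralVec ∅ p.rep := by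
  rwa [← Projectivization.mk_rep p, mk_mem_generalLocus_iff] at hp

theorem gradVanishes_smul_iff {a b : ℂ} (ha : a ≠ 0) (hb : b ≠ 0) {c : Fin 5 → ℂ}
    {v : Fin 4 → ℂ} : GradVanishes (a • c) (b • v) ↔ GradVanishes c v := by
  refine ⟨fun h => ?_, fun h => h.smul a b⟩
  simpa [smul_smul, ha, hb] using h.smul a⁻¹ b⁻¹

theorem gradVanishes_rep_mk_iff {c : Fin 5 → ℂ} {v : Fin 4 → ℂ} (hv : v ≠ 0) :
    GradVanishes c (Projectivization.mk ℂ v hv).rep ↔ GradVanishes c v := by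
  obtain ⟨a, ha, e⟩ := exists_smul_rep hv
  rw [e]
  simpa using gradVanishes_smul_iff one_ne_zero ha (c := c) (v := v)

theorem mem_tropeSet_mk_iff {c : Fin 5 → ℂ} (hc : c ≠ 0) (h : GeneralVec ∅ c) (T : P3) :
    T ∈ tropeSet (Projectivization.mk ℂ c hc) ↔ GradVanishes (residualVec c) T.rep := by
  constructor
  · rintro ⟨p₁, h1, h2⟩
    obtain ⟨-, k, hk, e⟩ := h1.exists_rep_eq hc h.segre
    rw [isSingularPoint_quartic_iff, e] at h2
    have := gradVanishes_smul_iff hk one_ne_zero (c := residualVec c) (v := T.rep)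
    rw [one_smul] at this
    exact this.1 h2
  · intro h1
    refine ⟨_, isResidualPoint_mk hc h.segre h.cone, ?_⟩
    obtain ⟨a, -, e⟩ := exists_smul_rep (residualVec_ne_zero h.segre h.cone)
    rw [isSingularPoint_quartic_iff, e]
    simpa using h1.smul a 1

theorem mem_tropeSet_iff {p : P4} (hp : p ∈ generalLocus) (T : P3) :
    T ∈ tropeSet p ↔ GradVanishes (residualVec p.rep) T.rep := by
  have := mem_tropeSet_mk_iff p.rep_nonzero (generalVec_rep hp) T
  rwa [Projectivization.mk_rep] at this

theorem isTrope_of_mem_tropeSet {p : P4} (hp : p ∈ generalLocus) {p₁ : P4}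
    (h : IsResidualPoint p p₁) {T : P3} (hT : T ∈ tropeSet p) : IsTrope (quartic p₁.rep) T := by
  have g := generalVec_rep hp
  rw [mem_tropeSet_iff hp] at hT
  rw [← Projectivization.mk_rep p] at h
  obtain ⟨-, k, hk, e⟩ := h.exists_rep_eq p.rep_nonzero g.segre
  rw [e]
  refine isTrope_of_gradVanishes (fun H => ?_) (by simpa using hT.smul k 1)
  rw [form_smul]
  exact mul_ne_zero hk (g.offHyperplanes H)

/-! ### The action of `Γ` on the tropes -/

/-- The generators preserve every quartic of the family. As they are involutions, one implication
suffices for each. -/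
theorem gradVanishes_gam_iff {c : Fin 5 → ℂ} {g : Equiv.Perm P3} (hg : g ∈ Gam) (T : P3) :
    GradVanishes c (g T).rep ↔ GradVanishes c T.rep := by
  have gen {l : (Fin 4 → ℂ) ≃ₗ[ℂ] (Fin 4 → ℂ)} (hl : ∀ v, GradVanishes c v → GradVanishes c (l v))
      (hl2 : ∀ v, l (l v) = v) (T : P3) :
      GradVanishes c (projPerm l T).rep ↔ GradVanishes c T.rep := by
    induction T using Projectivization.ind with
    | h v hv =>
      rw [projPerm_mk l hv (l.map_ne_zero_iff.2 hv), gradVanishes_rep_mk_iff,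
        gradVanishes_rep_mk_iff]
      exact ⟨fun h => hl2 v ▸ hl _ h, hl v⟩
  induction hg using Subgroup.closure_induction generalizing T with
  | mem x hx =>
    rcases hx with rfl | rfl | rfl | rfl
    · exact gen (fun v h => h.lin₁) (fun v => by ext i; fin_cases i <;> rfl) T
    · exact gen (fun v h => h.lin₂) (fun v => by ext i; fin_cases i <;> rfl) T
    · exact gen (fun v h => h.lin₃) (fun v => by
        ext i; fin_cases i <;> simp [lin₃_apply]) T
    · exact gen (fun v h => h.lin₄) (fun v => by
        ext i; fin_cases i <;> simp [lin₄_apply]) T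
  | one => rfl
  | mul x y _ _ hx hy => exact (hx (y T)).trans (hy T)
  | inv x _ hx =>
    have := hx (x⁻¹ T)
    rw [show x (x⁻¹ T) = T from x.apply_symm_apply T] at this
    exact this.symm

theorem gam_mem_tropeSet_iff {p : P4} (hp : p ∈ generalLocus) (g : Gam) (T : P3) :
    (g : Equiv.Perm P3) T ∈ tropeSet p ↔ T ∈ tropeSet p := by
  rw [mem_tropeSet_iff hp, mem_tropeSet_iff hp, gradVanishes_gam_iff g.2]

theorem exists_gam_eq {p : P4} (hp : p ∈ generalLocus) {T T' : P3} (hT : T ∈ tropeSet p)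
    (hT' : T' ∈ tropeSet p) : ∃ g : Gam, (g : Equiv.Perm P3) T = T' := by
  rw [mem_tropeSet_iff hp] at hT hT'
  obtain ⟨_, _, g, hg, e⟩ := gamRel_of_gradVanishes (generalVec_rep hp).offHyperplanes
    T.rep_nonzero T'.rep_nonzero hT hT'
  rw [Projectivization.mk_rep, Projectivization.mk_rep] at e
  exact ⟨⟨g, hg⟩, e⟩

theorem ratio_ne_zero_of_mem {p : P4} (hp : p ∈ generalLocus) {T : P3} (hT : T ∈ tropeSet p)
    (i : Fin 4) : ratio T i ≠ 0 := by
  rw [mem_tropeSet_iff hp] at hT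
  exact ratio_ne_zero (generalVec_rep hp).offHyperplanes hT i

theorem eq_one_of_gam_fix {p : P4} (hp : p ∈ generalLocus) {T : P3} (hT : T ∈ tropeSet p)
    {g g' : Gam} (h : (g : Equiv.Perm P3) T = (g' : Equiv.Perm P3) T) : g = g' :=
  eq_of_ratio_eq (ratio_ne_zero_of_mem hp hT) (by rw [h])

theorem tropeSet_nonempty {p : P4} (hp : p ∈ generalLocus) : (tropeSet p).Nonempty := by
  obtain ⟨v, hv, h⟩ := exists_gradVanishes (generalVec_rep hp).offHyperplanes
    (segreCubic_residualVec _)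
  exact ⟨Projectivization.mk ℂ v hv, (mem_tropeSet_iff hp _).2 ((gradVanishes_rep_mk_iff hv).2 h)⟩

/-- The fibre is nonempty and `Γ`, of order `16`, acts on it simply transitively. -/
theorem ncard_tropeSet {p : P4} (hp : p ∈ generalLocus) : (tropeSet p).ncard = 16 := by
  obtain ⟨T, hT⟩ := tropeSet_nonempty hp
  have e : tropeSet p = Set.range fun g : Gam => (g : Equiv.Perm P3) T := by
    ext T'
    refine ⟨fun h => exists_gam_eq hp hT h, ?_⟩
    rintro ⟨g, rfl⟩
    exact (gam_mem_tropeSet_iff hp g T).2 hT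
  rw [e, ← Nat.card_coe_set_eq,
    Nat.card_range_of_injective fun g g' h => eq_one_of_gam_fix hp hT h, card_gam]

theorem generalLocus_nonempty : generalLocus.Nonempty := by
  have h : GeneralVec ∅ ![1, 1, 3, 5, 11] := by
    refine ⟨?_, fun H _ => ?_, ?_⟩
    · simp [segreCubic]; norm_num
    · cases H <;> simp [SingularHyperplane.form] <;> norm_num
    · simp [nodeCone]; norm_num
  exact ⟨_, (mk_mem_generalLocus_iff h.ne_zero).2 h⟩

/-! ### Topology of projective spaces -/

/-- The saturation of an open set is the union of its multiples by nonzero scalars. Openness makes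
products of these quotient maps quotient maps again, as needed for closed conditions on pairs of
points. -/
theorem isOpenQuotientMap_projMk (n : ℕ) :
    IsOpenQuotientMap fun v : {v : Fin n → ℂ // v ≠ 0} => Projectivization.mk ℂ v.1 v.2 := by
  refine ⟨fun p => ⟨⟨p.rep, p.rep_nonzero⟩, p.mk_rep⟩, continuous_quotient_mk', fun U hU => ?_⟩
  refine isOpen_coinduced.2 ?_
  have e : (Quotient.mk (projectivizationSetoid ℂ (Fin n → ℂ))) ⁻¹'
      ((fun v : {v : Fin n → ℂ // v ≠ 0} => Projectivization.mk ℂ v.1 v.2) '' U) =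
      ⋃ a : ℂˣ, (fun v : {v : Fin n → ℂ // v ≠ 0} =>
        (⟨(a : ℂ) • v.1, smul_ne_zero a.ne_zero v.2⟩ : {v : Fin n → ℂ // v ≠ 0})) ⁻¹' U := by
    ext v
    simp only [Set.mem_preimage, Set.mem_iUnion]
    constructor
    · rintro ⟨u, hu, h⟩
      obtain ⟨a, ha⟩ := (Projectivization.mk_eq_mk_iff ℂ _ _ u.2 v.2).1 h
      refine ⟨a, ?_⟩
      convert hu using 1
      exact Subtype.ext ha
    · rintro ⟨a, ha⟩
      refine ⟨_, ha, ?_⟩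
      exact (Projectivization.mk_eq_mk_iff' ℂ _ _ _ v.2).2 ⟨a, rfl⟩
  exact e ▸ isOpen_iUnion fun a => hU.preimage (by fun_prop)

theorem continuous_projMk {X : Type*} [TopologicalSpace X] {n : ℕ} {f : X → Fin n → ℂ}
    (hf : Continuous f) (h : ∀ x, f x ≠ 0) :
    Continuous fun x => Projectivization.mk ℂ (f x) (h x) :=
  (isOpenQuotientMap_projMk n).continuous.comp (hf.subtype_mk h)

instance compactSpace_proj (n : ℕ) : CompactSpace (ℙ ℂ (Fin n → ℂ)) := by
  have h0 : ∀ x : Metric.sphere (0 : Fin n → ℂ) 1, x.1 ≠ 0 := fun x h => by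
    have := x.2; rw [h] at this; simp at this
  have hs : Function.Surjective fun x : Metric.sphere (0 : Fin n → ℂ) 1 =>
      Projectivization.mk ℂ x.1 (h0 x) := fun p => by
    have hp : ‖p.rep‖ ≠ 0 := norm_ne_zero_iff.2 p.rep_nonzero
    refine ⟨⟨((‖p.rep‖ : ℂ)⁻¹) • p.rep, ?_⟩, ?_⟩
    · simp [norm_smul, hp]
    · conv_rhs => rw [← p.mk_rep]
      exact (Projectivization.mk_eq_mk_iff' ℂ _ _ _ _).2 ⟨_, rfl⟩
  have := isCompact_range (continuous_projMk continuous_subtype_val h0)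
  rw [hs.range_eq] at this
  exact ⟨this⟩

instance t2Space_proj (n : ℕ) : T2Space (ℙ ℂ (Fin n → ℂ)) := by
  rw [t2Space_iff_of_isOpenQuotientMap (isOpenQuotientMap_projMk n)]
  have e : {q : {v : Fin n → ℂ // v ≠ 0} × {v : Fin n → ℂ // v ≠ 0} |
      Projectivization.mk ℂ q.1.1 q.1.2 = Projectivization.mk ℂ q.2.1 q.2.2} =
      ⋂ (i : Fin n) (j : Fin n), {q | q.1.1 i * q.2.1 j = q.1.1 j * q.2.1 i} := by
    ext ⟨⟨v, hv⟩, ⟨w, hw⟩⟩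
    simp only [Set.mem_ofPred_eq, Set.mem_iInter, Projectivization.mk_eq_mk_iff']
    constructor
    · rintro ⟨a, rfl⟩ i j
      simp only [Pi.smul_apply, smul_eq_mul]; ring
    · intro h
      obtain ⟨k, hk⟩ := Function.ne_iff.1 hw
      rw [Pi.zero_apply] at hk
      refine ⟨v k / w k, funext fun i => ?_⟩
      simp only [Pi.smul_apply, smul_eq_mul]
      field_simp
      linear_combination h k i
  rw [e]
  have h1 (i : Fin n) : Continuous fun q : {v : Fin n → ℂ // v ≠ 0} × {v : Fin n → ℂ // v ≠ 0} =>
      q.1.1 i := (continuous_apply i).comp (continuous_subtype_val.comp continuous_fst)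
  have h2 (i : Fin n) : Continuous fun q : {v : Fin n → ℂ // v ≠ 0} × {v : Fin n → ℂ // v ≠ 0} =>
      q.2.1 i := (continuous_apply i).comp (continuous_subtype_val.comp continuous_snd)
  exact isClosed_iInter fun i => isClosed_iInter fun j =>
    isClosed_eq ((h1 i).mul (h2 j)) ((h1 j).mul (h2 i))

theorem continuous_projPerm (g : (Fin 4 → ℂ) ≃ₗ[ℂ] (Fin 4 → ℂ)) : Continuous (projPerm g) := by
  rw [(isOpenQuotientMap_projMk 4).isQuotientMap.continuous_iff]
  exact continuous_projMk (f := fun v : {v : Fin 4 → ℂ // v ≠ 0} => g v.1)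
    (g.toLinearMap.continuous_of_finiteDimensional.comp continuous_subtype_val)
    fun v => g.map_ne_zero_iff.2 v.2

theorem continuous_gam (g : Gam) : Continuous (g : Equiv.Perm P3) := by
  have : (g : Equiv.Perm P3) ∈ wordHom.range := by rw [range_wordHom]; exact g.2
  obtain ⟨f, hf⟩ := this
  rw [← hf]
  simp only [wordHom, MonoidHom.coe_mk, OneHom.coe_mk, Equiv.Perm.coe_mul]
  simp only [Equiv.Perm.coe_pow]
  exact ((((continuous_projPerm _).iterate _).comp ((continuous_projPerm _).iterate _)).comp
    ((continuous_projPerm _).iterate _)).comp ((continuous_projPerm _).iterate _)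

theorem continuous_segreCubic : Continuous segreCubic := by
  unfold segreCubic; fun_prop

theorem continuous_nodeCone : Continuous nodeCone := by
  unfold nodeCone; fun_prop

theorem continuous_form (H : SingularHyperplane) : Continuous H.form := by
  cases H <;> unfold SingularHyperplane.form <;> fun_prop

theorem continuous_residualVec : Continuous residualVec := by
  have := continuous_segreCubic
  have := continuous_nodeCone
  unfold residualVec
  fun_prop

/-! ### The covering -/

/-- Representatives do not vary continuously, so closedness is tested on the quotient by nonzero
vectors. There the condition becomes polynomial, because the equations are homogeneous and
`residualVec` is homogeneous of degree three. -/
theorem isClosed_singular :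
    IsClosed {q : P4 × P3 | GradVanishes (residualVec q.1.rep) q.2.rep} := by
  rw [← ((isOpenQuotientMap_projMk 5).prodMap
    (isOpenQuotientMap_projMk 4)).isQuotientMap.isClosed_preimage]
  have e : (Prod.map (fun v : {v : Fin 5 → ℂ // v ≠ 0} => Projectivization.mk ℂ v.1 v.2)
      (fun v : {v : Fin 4 → ℂ // v ≠ 0} => Projectivization.mk ℂ v.1 v.2)) ⁻¹'
      {q : P4 × P3 | GradVanishes (residualVec q.1.rep) q.2.rep} =
      {q | GradVanishes (residualVec q.1.1) q.2.1} := by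
    ext ⟨⟨c, hc⟩, ⟨v, hv⟩⟩
    simp only [Set.mem_preimage, Prod.map_apply, Set.mem_ofPred_eq]
    obtain ⟨a, ha, e⟩ := exists_smul_rep hc
    rw [gradVanishes_rep_mk_iff, e, residualVec_smul]
    simpa using gradVanishes_smul_iff (pow_ne_zero 3 ha) one_ne_zero (c := residualVec c) (v := v)
  rw [e]
  have hr (i : Fin 5) : Continuous fun q : {v : Fin 5 → ℂ // v ≠ 0} × {v : Fin 4 → ℂ // v ≠ 0} =>
      residualVec q.1.1 i :=
    (continuous_apply i).comp (continuous_residualVec.comp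
      (continuous_subtype_val.comp continuous_fst))
  have hv (i : Fin 4) : Continuous fun q : {v : Fin 5 → ℂ // v ≠ 0} × {v : Fin 4 → ℂ // v ≠ 0} =>
      q.2.1 i := (continuous_apply i).comp (continuous_subtype_val.comp continuous_snd)
  have hv0 := hv 0; have hv1 := hv 1; have hv2 := hv 2; have hv3 := hv 3
  have hr0 := hr 0; have hr1 := hr 1; have hr2 := hr 2; have hr3 := hr 3; have hr4 := hr 4
  simp only [gradVanishes_iff, Set.ofPred_and]
  refine .inter ?_ (.inter ?_ (.inter ?_ ?_)) <;>
    exact isClosed_eq (by fun_prop) continuous_const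

theorem tropeCover_range_isClosed :
    IsClosed {z : generalLocus × P3 | z.2 ∈ tropeSet z.1} := by
  have e : {z : generalLocus × P3 | z.2 ∈ tropeSet z.1} =
      (fun z : generalLocus × P3 => ((z.1 : P4), z.2)) ⁻¹'
        {q : P4 × P3 | GradVanishes (residualVec q.1.rep) q.2.rep} := by
    ext ⟨p, T⟩
    exact mem_tropeSet_iff p.2 T
  rw [e]
  exact isClosed_singular.preimage (by fun_prop)

theorem continuous_tropeProj : Continuous tropeProj :=
  continuous_fst.comp continuous_subtype_val

theorem continuous_plane : Continuous TropeCover.plane :=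
  continuous_snd.comp continuous_subtype_val

/-- The tropes form a closed subset of a product with the compact space `P3`, and projection along a
compact factor is closed. -/
theorem isClosedMap_tropeProj : IsClosedMap tropeProj :=
  isClosedMap_fst_of_compactSpace.comp
    tropeCover_range_isClosed.isClosedEmbedding_subtypeVal.isClosedMap

theorem surjective_tropeProj : Function.Surjective tropeProj := fun p => by
  obtain ⟨T, hT⟩ := tropeSet_nonempty p.2
  exact ⟨⟨(p, T), hT⟩, rfl⟩

theorem TropeCover.ext {z z' : TropeCover} (h : tropeProj z = tropeProj z')
    (h' : z.plane = z'.plane) : z = z' :=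
  Subtype.ext (Prod.ext h h')

theorem TropeCover.plane_mem (z : TropeCover) : z.plane ∈ tropeSet (tropeProj z) := z.2

instance tropeCoverMulAction : MulAction Gam TropeCover where
  smul g z := ⟨(tropeProj z, (g : Equiv.Perm P3) z.plane),
    (gam_mem_tropeSet_iff (tropeProj z).2 g _).2 z.2⟩
  one_smul _ := rfl
  mul_smul _ _ _ := rfl

theorem tropeProj_smul (g : Gam) (z : TropeCover) : tropeProj (g • z) = tropeProj z := rfl

instance t2Space_tropeCover : T2Space TropeCover :=
  inferInstanceAs (T2Space {z : generalLocus × P3 // z.2 ∈ tropeSet z.1})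

instance finite_gam : Finite Gam := Nat.finite_of_card_ne_zero (by rw [card_gam]; norm_num)

theorem continuous_smul_tropeCover (g : Gam) : Continuous fun z : TropeCover => g • z :=
  Continuous.subtype_mk (continuous_tropeProj.prodMk
    ((continuous_gam g).comp continuous_plane)) _

theorem isQuotientCoveringMap_tropeProj : IsQuotientCoveringMap tropeProj Gam where
  toIsQuotientMap := isClosedMap_tropeProj.isQuotientMap continuous_tropeProj surjective_tropeProj
  continuous_const_smul := continuous_smul_tropeCover
  apply_eq_iff_mem_orbit {z z'} := by
    constructor
    · intro h
      obtain ⟨g, hg⟩ := exists_gam_eq (tropeProj z').2 z'.plane_mem (h ▸ z.plane_mem)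
      exact ⟨g, TropeCover.ext (by exact h.symm) hg⟩
    · rintro ⟨g, rfl⟩; rfl
  -- A finite group acting freely and continuously on a Hausdorff space: each `g ≠ 1` moves some
  -- neighbourhood of `z` off itself, and finitely many such neighbourhoods are intersected.
  disjoint z := by
    have h : ∀ g : Gam, ∃ U ∈ 𝓝 z, ((g • ·) '' U ∩ U).Nonempty → g = 1 := fun g => by
      by_cases hg : g = 1
      · exact ⟨Set.univ, Filter.univ_mem, fun _ => hg⟩
      · have hne : g • z ≠ z := fun h => hg
          (eq_one_of_gam_fix (tropeProj z).2 z.plane_mem (congrArg TropeCover.plane h))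
        obtain ⟨A, B, hA, hB, hgA, hzB, hAB⟩ := t2_separation hne
        refine ⟨(fun y : TropeCover => g • y) ⁻¹' A ∩ B, Filter.inter_mem
          ((hA.preimage (continuous_smul_tropeCover g)).mem_nhds hgA) (hB.mem_nhds hzB), ?_⟩
        rintro ⟨_, ⟨y, hy, rfl⟩, hy'⟩
        exact absurd hy'.2 (Set.disjoint_left.1 hAB hy.1)
    choose U hU hU' using h
    refine ⟨⋂ g, U g, Filter.iInter_mem.2 hU, fun g hg => hU' g ?_⟩
    exact hg.mono (Set.inter_subset_inter (Set.image_mono (Set.iInter_subset _ g))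
      (Set.iInter_subset _ g))

/-! ### The general locus is path connected -/

instance finite_singularHyperplane : Finite SingularHyperplane := by
  refine Set.finite_univ_iff.1 (Set.Finite.subset (List.finite_toSet
    [.A, .qpC, .qmC, .qpD, .qmD, .qpE, .qmE, .pp0, .pp1, .pp2, .pp3, .pm0, .pm1, .pm2, .pm3])
    fun H _ => ?_)
  cases H <;> simp

theorem countable_zeros {g : ℂ → ℂ} {P : Polynomial ℂ} (hg : ∀ t, g t = P.eval t) {a : ℂ}
    (h : g a ≠ 0) : {t | g t = 0}.Countable := by
  have hP : P ≠ 0 := by rintro rfl; simp [hg] at h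
  refine (P.rootSet_finite ℂ).countable.mono fun t ht => ?_
  rw [Polynomial.mem_rootSet]
  exact ⟨hP, by simpa [hg] using ht⟩

theorem countable_not_generalVec {P D : Fin 5 → ℂ} (hP : GeneralVec ∅ P) :
    {t : ℂ | ¬ GeneralVec ∅ (P + t • D)}.Countable := by
  let L (i : Fin 5) : Polynomial ℂ := .C (P i) + .X * .C (D i)
  have hL (t : ℂ) (i : Fin 5) : (P + t • D) i = (L i).eval t := by
    simp [L]; ring
  have c1 : {t : ℂ | segreCubic (P + t • D) = 0}.Countable := by
    refine countable_zeros (P := 16 * L 0 ^ 3 + L 0 * L 1 ^ 2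
      - 4 * L 0 * (L 2 ^ 2 + L 3 ^ 2 + L 4 ^ 2) + 4 * L 2 * L 3 * L 4) (fun t => ?_) (a := 0)
      (by simpa using hP.segre)
    simp only [segreCubic, hL]
    simp
  have c2 : {t : ℂ | nodeCone (P + t • D) = 0}.Countable := by
    refine countable_zeros (P := 48 * L 0 ^ 2 + L 1 ^ 2 - 4 * (L 2 ^ 2 + L 3 ^ 2 + L 4 ^ 2)
      + 16 * L 0 * (L 2 + L 3 - L 4) + 8 * (L 2 * L 3 - L 2 * L 4 - L 3 * L 4)) (fun t => ?_)
      (a := 0) (by simpa using hP.cone)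
    simp only [nodeCone, hL]
    simp
  have c3 (H : SingularHyperplane) : {t : ℂ | H.form (P + t • D) = 0}.Countable := by
    refine countable_zeros (P := .C (H.form P) + .X * .C (H.form D)) (fun t => ?_)
      (a := 0) (by simpa using hP.form H (Set.notMem_empty H))
    simp [form_add, form_smul]; ring
  refine ((c1.union c2).union (Set.countable_iUnion c3)).mono fun t ht => ?_
  by_contra hn
  simp only [Set.mem_union, Set.mem_iUnion, Set.mem_ofPred_eq, not_or, not_exists] at hn
  exact ht ⟨hn.1.1, fun H _ => hn.2 H, hn.1.2⟩

/-- On the complex line through two general points the conditions fail only at zeros of finitely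
many nonzero polynomials, and the complement of a countable set in `ℂ` is path connected. -/
theorem joined_generalLocus (p q : generalLocus) : Joined p q := by
  have hp := generalVec_rep p.2
  have hq := generalVec_rep q.2
  set f : ℂ → Fin 5 → ℂ := fun t => (p : P4).rep + t • ((q : P4).rep - (p : P4).rep) with hf
  have f0 : f 0 = (p : P4).rep := by simp [hf]
  have f1 : f 1 = (q : P4).rep := by simp [hf]
  have hpc := (countable_not_generalVec (D := (q : P4).rep - (p : P4).rep)
    hp).isPathConnected_compl_of_one_lt_rank (by rw [Complex.rank_real_complex]; norm_num)
  obtain ⟨γ, hγ⟩ := hpc.joinedIn 0 (by simpa using hp) 1 (by simpa using hq)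
  have hg (t : unitInterval) : GeneralVec ∅ (f (γ t)) := not_not.1 (hγ t)
  refine ⟨⟨⟨fun t => ⟨Projectivization.mk ℂ (f (γ t)) (hg t).ne_zero,
    (mk_mem_generalLocus_iff _).2 (hg t)⟩, ?_⟩, ?_, ?_⟩⟩
  · refine Continuous.subtype_mk (continuous_projMk (f := fun t => f (γ t)) ?_ _) _
    have := γ.continuous
    fun_prop
  · apply Subtype.ext
    conv_rhs => rw [← Projectivization.mk_rep (p : P4)]
    simp only [γ.source, f0]
  · apply Subtype.ext
    conv_rhs => rw [← Projectivization.mk_rep (q : P4)]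
    simp only [γ.target, f1]

/-! ### Loops around the singular hyperplanes -/

theorem isOpen_generalVec (S : Set SingularHyperplane) : IsOpen {c | GeneralVec S c} := by
  have e : {c | GeneralVec S c} = {c | segreCubic c ≠ 0} ∩ {c | nodeCone c ≠ 0} ∩
      ⋂ H : SingularHyperplane, {c | H ∉ S → H.form c ≠ 0} := by
    ext c
    simp only [Set.mem_inter_iff, Set.mem_iInter, Set.mem_ofPred_eq]
    exact ⟨fun h => ⟨⟨h.segre, h.cone⟩, h.form⟩, fun h => ⟨h.1.1, h.2, h.1.2⟩⟩
  rw [e]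
  refine ((isOpen_ne_fun continuous_segreCubic continuous_const).inter
    (isOpen_ne_fun continuous_nodeCone continuous_const)).inter (isOpen_iInter_of_finite fun H => ?_)
  by_cases hH : H ∈ S
  · simp [hH]
  · simpa [hH] using isOpen_ne_fun (continuous_form H) continuous_const

/-- On each singular hyperplane through the node there is a point that is otherwise general. -/
theorem exists_generalVec_on {H : SingularHyperplane} (hH : H.form nodeVec = 0) :
    ∃ u, H.form u = 0 ∧ GeneralVec {H} u := by
  have aux {H : SingularHyperplane} {u : Fin 5 → ℂ} (h0 : H.form u = 0) (h1 : segreCubic u ≠ 0)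
      (h2 : nodeCone u ≠ 0) (h3 : ∀ K : SingularHyperplane, K = H ∨ K.form u ≠ 0) :
      ∃ u, H.form u = 0 ∧ GeneralVec {H} u :=
    ⟨u, h0, h1, fun K hK => (h3 K).resolve_left hK, h2⟩
  cases H
  case qpC =>
    refine aux (u := ![1, -1, -2, 0, 0]) ?_ ?_ ?_ fun K => ?_
    rotate_left 3
    · cases K <;> simp [SingularHyperplane.form] <;> norm_num
    all_goals (simp [SingularHyperplane.form, segreCubic, nodeCone]; try norm_num)
  case qpD =>
    refine aux (u := ![1, -1, 0, -2, 0]) ?_ ?_ ?_ fun K => ?_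
    rotate_left 3
    · cases K <;> simp [SingularHyperplane.form] <;> norm_num
    all_goals (simp [SingularHyperplane.form, segreCubic, nodeCone]; try norm_num)
  case qmE =>
    refine aux (u := ![1, -1, 0, 0, 2]) ?_ ?_ ?_ fun K => ?_
    rotate_left 3
    · cases K <;> simp [SingularHyperplane.form] <;> norm_num
    all_goals (simp [SingularHyperplane.form, segreCubic, nodeCone]; try norm_num)
  case pp0 =>
    refine aux (u := ![1, 2, -1, -1, -1]) ?_ ?_ ?_ fun K => ?_
    rotate_left 3
    · cases K <;> simp [SingularHyperplane.form] <;> norm_num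
    all_goals (simp [SingularHyperplane.form, segreCubic, nodeCone]; try norm_num)
  case pm0 =>
    refine aux (u := ![1, -2, -1, -1, -1]) ?_ ?_ ?_ fun K => ?_
    rotate_left 3
    · cases K <;> simp [SingularHyperplane.form] <;> norm_num
    all_goals (simp [SingularHyperplane.form, segreCubic, nodeCone]; try norm_num)
  case pp1 =>
    refine aux (u := ![1, 2, -1, 1, 1]) ?_ ?_ ?_ fun K => ?_
    rotate_left 3
    · cases K <;> simp [SingularHyperplane.form] <;> norm_num
    all_goals (simp [SingularHyperplane.form, segreCubic, nodeCone]; try norm_num)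
  case pm1 =>
    refine aux (u := ![1, -2, -1, 1, 1]) ?_ ?_ ?_ fun K => ?_
    rotate_left 3
    · cases K <;> simp [SingularHyperplane.form] <;> norm_num
    all_goals (simp [SingularHyperplane.form, segreCubic, nodeCone]; try norm_num)
  case pp2 =>
    refine aux (u := ![1, 2, 1, -1, 1]) ?_ ?_ ?_ fun K => ?_
    rotate_left 3
    · cases K <;> simp [SingularHyperplane.form] <;> norm_num
    all_goals (simp [SingularHyperplane.form, segreCubic, nodeCone]; try norm_num)
  case pm2 =>
    refine aux (u := ![1, -2, 1, -1, 1]) ?_ ?_ ?_ fun K => ?_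
    rotate_left 3
    · cases K <;> simp [SingularHyperplane.form] <;> norm_num
    all_goals (simp [SingularHyperplane.form, segreCubic, nodeCone]; try norm_num)
  all_goals (simp [SingularHyperplane.form, nodeVec] at hH <;> norm_num at hH)

/-- The boundary circle of the unit disc. -/
noncomputable def circ (t : unitInterval) : ℂ := Complex.exp (2 * Real.pi * Complex.I * (t : ℝ))

theorem circ_zero : circ 0 = 1 := by simp [circ]

theorem circ_one : circ 1 = 1 := by simp [circ, Complex.exp_two_pi_mul_I]

theorem norm_circ (t : unitInterval) : ‖circ t‖ = 1 := by
  rw [circ, show (2 * Real.pi * Complex.I * (t : ℝ) : ℂ) = ((2 * Real.pi * t : ℝ) : ℂ) * Complex.I by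
    push_cast; ring, Complex.norm_exp_ofReal_mul_I]

theorem circ_ne_zero (t : unitInterval) : circ t ≠ 0 := Complex.exp_ne_zero _

theorem continuous_circ : Continuous circ := by unfold circ; fun_prop

theorem exists_isLoopAround {H : SingularHyperplane} (hH : H.form nodeVec = 0)
    (p : generalLocus) : ∃ l : Path p p, IsLoopAround H l := by
  obtain ⟨u, hu, gu⟩ := exists_generalVec_on hH
  obtain ⟨δ, hδ, hball⟩ := Metric.isOpen_iff.1 (isOpen_generalVec {H}) u gu
  -- Every singular form has a nonzero coefficient of `A`, so this direction is transversal to all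
  -- the hyperplanes. The length `δ / 2` keeps the closed disc inside the ball where the other
  -- conditions hold.
  set v : Fin 5 → ℂ := Pi.single 0 ((δ / 2 : ℝ) : ℂ) with hv
  have hvH : H.form v ≠ 0 := by
    have hδ' : (δ : ℂ) ≠ 0 := by exact_mod_cast hδ.ne'
    cases H <;> simp [SingularHyperplane.form, hv, hδ']
  have hg1 (s : ℂ) (hs : ‖s‖ ≤ 1) : GeneralVec {H} (u + s • v) := by
    apply hball
    rw [Metric.mem_ball, dist_self_add_left, norm_smul, hv, Pi.norm_single, Complex.norm_real,
      Real.norm_of_nonneg (by positivity)]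
    nlinarith
  have hg2 (s : ℂ) (hs : ‖s‖ ≤ 1) (hs0 : s ≠ 0) : GeneralVec ∅ (u + s • v) := by
    refine ⟨(hg1 s hs).segre, fun K _ => ?_, (hg1 s hs).cone⟩
    by_cases hK : K = H
    · rw [hK, form_add, form_smul, hu, zero_add]
      exact mul_ne_zero hs0 hvH
    · exact (hg1 s hs).form K hK
  have hc (t : unitInterval) : GeneralVec ∅ (u + circ t • v) :=
    hg2 _ (norm_circ t).le (circ_ne_zero t)
  let b : generalLocus := ⟨Projectivization.mk ℂ (u + circ 0 • v) (hc 0).ne_zero,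
    (mk_mem_generalLocus_iff _).2 (hc 0)⟩
  let c : Path b b := ⟨⟨fun t => ⟨Projectivization.mk ℂ (u + circ t • v) (hc t).ne_zero,
    (mk_mem_generalLocus_iff _).2 (hc t)⟩, Continuous.subtype_mk
      (continuous_projMk (f := fun t => u + circ t • v)
        (by have := continuous_circ; fun_prop) _) _⟩, rfl, Subtype.ext (by simp [b, circ_one,
        circ_zero])⟩
  obtain ⟨d⟩ := joined_generalLocus p b
  exact ⟨d.trans (c.trans d.symm), u, v, fun s hs => (hg1 s hs).ne_zero, hu,
    (isGeneralOutside_mk_iff _).2 (hg1 0 (by simp)),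
    fun s hs hs0 => (mk_mem_generalLocus_iff _).2 (hg2 s hs hs0), b, c, d,
    fun t => ⟨(hc t).ne_zero, rfl⟩, .refl _⟩

/-! ### Square roots of linear forms along the boundary of a disc -/

open Classical in
/-- The sign by which a square root of the form of `K` changes along a loop around `H`. -/
noncomputable def loopSign (H K : SingularHyperplane) : ℂ := if K = H then -1 else 1

/-- For `K = H` the form is a multiple of `s = e^{2πit}`, with square root a multiple of `e^{πit}`.
For `K ≠ H` it has no zero in the disc, so it has a root that is single-valued on the circle. -/
theorem exists_sqrt_circ {H K : SingularHyperplane} {u v : Fin 5 → ℂ} (hu : H.form u = 0)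
    (hK : K ≠ H → ∀ s : ℂ, ‖s‖ ≤ 1 → K.form (u + s • v) ≠ 0) :
    ∃ r : unitInterval → ℂ, Continuous r ∧ (∀ t, r t ^ 2 = K.form (u + circ t • v)) ∧
      r 1 = loopSign H K * r 0 := by
  by_cases h : K = H
  · obtain ⟨b, hb⟩ := IsAlgClosed.exists_pow_nat_eq (K.form v) two_pos
    refine ⟨fun t => b * Complex.exp (Real.pi * Complex.I * (t : ℝ)), by fun_prop, fun t => ?_, ?_⟩
    · rw [form_add, form_smul, h, hu, ← h, ← hb, circ, mul_pow, ← Complex.exp_nat_mul]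
      rw [zero_add, mul_comm (Complex.exp _)]
      congr 2
      push_cast; ring
    · simp [loopSign, h, Complex.exp_pi_mul_I]
  · have hne := hK h
    have hu0 : K.form u ≠ 0 := by simpa using hne 0 (by simp)
    obtain ⟨a, ha⟩ := IsAlgClosed.exists_pow_nat_eq (K.form u) two_pos
    set q := K.form v / K.form u with hq
    have hv : K.form v = K.form u * q := by rw [hq]; field_simp
    -- Otherwise `s = -q⁻¹` would be a zero of the form in the closed disc. Hence `1 + sq` has
    -- positive real part on the circle and the principal root is continuous there.
    have hq1 : ‖q‖ < 1 := by
      by_contra hge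
      have hq0 : q ≠ 0 := by rintro h0; rw [h0] at hge; simp at hge
      refine hne (-q⁻¹) ?_ ?_
      · rw [norm_neg, norm_inv]; exact inv_le_one_of_one_le₀ (not_lt.1 hge)
      · rw [form_add, form_smul, hv]; field_simp; ring
    have hslit (t : unitInterval) : 1 + circ t * q ∈ Complex.slitPlane := by
      left
      have h1 : |(circ t * q).re| ≤ ‖circ t * q‖ := Complex.abs_re_le_norm _
      rw [norm_mul, norm_circ, one_mul] at h1
      rw [Complex.add_re, Complex.one_re]
      linarith [neg_abs_le (circ t * q).re]
    refine ⟨fun t => a * (1 + circ t * q) ^ (1 / 2 : ℂ), ?_, fun t => ?_, ?_⟩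
    · refine continuous_const.mul (Continuous.cpow (by have := continuous_circ; fun_prop)
        continuous_const hslit)
    · have := Complex.cpow_nat_inv_pow (1 + circ t * q) two_ne_zero
      rw [mul_pow, ha, form_add, form_smul, hv, one_div,
        show (2 : ℂ)⁻¹ = ((2 : ℕ) : ℂ)⁻¹ by norm_num, this]
      ring
    · simp [loopSign, h, circ_one, circ_zero]

theorem continuousAt_ratio {T : P3} (h1 : dq1 T.rep ≠ 0) (h2 : dq2 T.rep ≠ 0) (i : Fin 4) :
    ContinuousAt (fun T => ratio T i) T := by
  have := (isOpenQuotientMap_projMk 4).continuousAt_comp_iff (g := fun T => ratio T i)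
    (x := ⟨T.rep, T.rep_nonzero⟩)
  simp only [Projectivization.mk_rep] at this
  rw [← this]
  have e : ((fun T => ratio T i) ∘ fun v : {v : Fin 4 → ℂ // v ≠ 0} =>
      Projectivization.mk ℂ v.1 v.2) = fun v => ratioVec v.1 i := by
    ext v; simp [ratio_mk]
  rw [e]
  have k0 : ContinuousAt (fun v : {v : Fin 4 → ℂ // v ≠ 0} => dq0 v.1)
      ⟨T.rep, T.rep_nonzero⟩ :=
    ((show Continuous dq0 by unfold dq0; fun_prop).comp continuous_subtype_val).continuousAt
  have k1 : ContinuousAt (fun v : {v : Fin 4 → ℂ // v ≠ 0} => dq1 v.1)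
      ⟨T.rep, T.rep_nonzero⟩ :=
    ((show Continuous dq1 by unfold dq1; fun_prop).comp continuous_subtype_val).continuousAt
  have k2 : ContinuousAt (fun v : {v : Fin 4 → ℂ // v ≠ 0} => dq2 v.1)
      ⟨T.rep, T.rep_nonzero⟩ :=
    ((show Continuous dq2 by unfold dq2; fun_prop).comp continuous_subtype_val).continuousAt
  have kC : ContinuousAt (fun v : {v : Fin 4 → ℂ // v ≠ 0} => mqC v.1)
      ⟨T.rep, T.rep_nonzero⟩ :=
    ((show Continuous mqC by unfold mqC; fun_prop).comp continuous_subtype_val).continuousAt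
  have kD : ContinuousAt (fun v : {v : Fin 4 → ℂ // v ≠ 0} => mqD v.1)
      ⟨T.rep, T.rep_nonzero⟩ :=
    ((show Continuous mqD by unfold mqD; fun_prop).comp continuous_subtype_val).continuousAt
  fin_cases i
  exacts [k0.div k1 h1, k0.div k2 h2, kC.div k2 h2, kD.div k1 h1]

/-- The signs by which the semi-invariant functions change along a loop around `H`. -/
noncomputable def monodromySign (H : SingularHyperplane) (i : Fin 4) : ℂ :=
  loopSign H (sqDen i).1 * loopSign H (sqDen i).2 * (loopSign H (sqNum i).1 * loopSign H (sqNum i).2)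

/-- This compares the table with the sign rule: the function with index `i` changes sign exactly
when `H` is one of the four hyperplanes in its square. -/
theorem ratio_localMonodromy {H : SingularHyperplane} (hH : H.form nodeVec = 0) (T : P3) :
    ratio ((localMonodromy H : Equiv.Perm P3) T) = monodromySign H * ratio T := by
  have e1 (T : P3) : ratio ((γ₁ : Equiv.Perm P3) T) = ![1, -1, -1, 1] * ratio T := ratio_lin₁ T
  have e2 (T : P3) : ratio ((γ₂ : Equiv.Perm P3) T) = ![-1, 1, 1, -1] * ratio T := ratio_lin₂ T
  have e3 (T : P3) : ratio ((γ₃ : Equiv.Perm P3) T) = ![1, 1, 1, -1] * ratio T := ratio_lin₃ T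
  have e4 (T : P3) : ratio ((γ₄ : Equiv.Perm P3) T) = ![1, 1, -1, 1] * ratio T := ratio_lin₄ T
  cases H
  case A | qmC | qmD | qpE | pp3 | pm3 =>
    simp [SingularHyperplane.form, nodeVec] at hH <;> norm_num at hH
  all_goals
    simp only [localMonodromy, Subgroup.coe_mul, Equiv.Perm.mul_apply, e1, e2, e3, e4]
    ext i
    fin_cases i <;> simp [monodromySign, loopSign, sqDen, sqNum]

/-! ### Monodromy along the boundary of a disc -/

theorem form_sqNum_nodeVec (i : Fin 4) :
    (sqNum i).1.form nodeVec = 0 ∧ (sqNum i).2.form nodeVec = 0 := by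
  fin_cases i <;> simp [sqNum, SingularHyperplane.form, nodeVec] <;> norm_num

theorem form_sqDen_nodeVec (i : Fin 4) :
    (sqDen i).1.form nodeVec = 0 ∧ (sqDen i).2.form nodeVec = 0 := by
  fin_cases i <;> simp [sqDen, SingularHyperplane.form, nodeVec] <;> norm_num

theorem sqConst_ne_zero (i : Fin 4) : sqConst i ≠ 0 := by
  fin_cases i <;> simp [sqConst]

/-- The squares of the semi-invariant functions on the tropes over a general point. -/
theorem ratio_sq_of_residualVec {c : Fin 5 → ℂ} (hc : GeneralVec ∅ c) {T : P3}
    (h : GradVanishes (residualVec c) T.rep) (i : Fin 4) :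
    ratio T i ^ 2 * ((sqDen i).1.form c * (sqDen i).2.form c) =
      sqConst i * ((sqNum i).1.form c * (sqNum i).2.form c) := by
  have := ratio_sq hc.offHyperplanes h i
  rw [form_residualVec (form_sqNum_nodeVec i).1, form_residualVec (form_sqNum_nodeVec i).2,
    form_residualVec (form_sqDen_nodeVec i).1, form_residualVec (form_sqDen_nodeVec i).2] at this
  refine mul_left_cancel₀ (pow_ne_zero 2 hc.cone) ?_
  linear_combination this

/-- Along the lifted circle a semi-invariant function times its denominator is a continuous square
root of a product of four forms, up to a constant. It therefore changes by the product of the four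
loop signs. -/
theorem ratio_circle {H : SingularHyperplane} {u v : Fin 5 → ℂ} (hu : H.form u = 0)
    (h0 : GeneralVec {H} u) (hs : ∀ s : ℂ, ‖s‖ ≤ 1 → s ≠ 0 → GeneralVec ∅ (u + s • v))
    {Γ : unitInterval → TropeCover} (hΓ : Continuous Γ)
    (hg : ∀ t, GradVanishes (residualVec (u + circ t • v)) (Γ t).plane.rep) :
    ratio (Γ 1).plane = monodromySign H * ratio (Γ 0).plane := by
  have hw (t : unitInterval) : GeneralVec ∅ (u + circ t • v) :=
    hs _ (norm_circ t).le (circ_ne_zero t)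
  have hK (K : SingularHyperplane) (hKH : K ≠ H) (s : ℂ) (h : ‖s‖ ≤ 1) :
      K.form (u + s • v) ≠ 0 := by
    rcases eq_or_ne s 0 with rfl | hs0
    · simpa using h0.form K (by simpa using hKH)
    · exact (hs s h hs0).form K (Set.notMem_empty K)
  have hF (K : SingularHyperplane) (t : unitInterval) : K.form (u + circ t • v) ≠ 0 :=
    (hw t).form K (Set.notMem_empty K)
  have cF (K : SingularHyperplane) : Continuous fun t => K.form (u + circ t • v) :=
    (continuous_form K).comp (by have := continuous_circ; fun_prop)
  funext i
  obtain ⟨k, hk⟩ := IsAlgClosed.exists_pow_nat_eq (sqConst i) two_pos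
  have hk0 : k ≠ 0 := by rintro rfl; exact sqConst_ne_zero i (by rw [← hk]; simp)
  choose r rc rsq rone using fun K : SingularHyperplane => exists_sqrt_circ hu (hK K)
  have rne (K : SingularHyperplane) (t : unitInterval) : r K t ≠ 0 := fun h =>
    hF K t (by rw [← rsq, h]; simp)
  have cR : Continuous fun t => ratio (Γ t).plane i := by
    rw [continuous_iff_continuousAt]
    intro t
    obtain ⟨-, h1, h2, -⟩ := dq_ne_zero (hw t).offHyperplanes (hg t) (Γ t).plane.rep_nonzero
    exact ContinuousAt.comp (g := fun T => ratio T i) (f := fun t => (Γ t).plane)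
      (continuousAt_ratio h1 h2 i) (continuous_plane.comp hΓ).continuousAt
  -- Multiplying by the denominator, rather than dividing, makes `y²` a constant times a product of
  -- four forms. Since `x` has the same square and no zeros, and the interval is connected, `y = x`
  -- or `y = -x` throughout.
  set y : unitInterval → ℂ := fun t => ratio (Γ t).plane i *
    ((sqDen i).1.form (u + circ t • v) * (sqDen i).2.form (u + circ t • v)) with hy
  set x : unitInterval → ℂ := fun t => k *
    (r (sqDen i).1 t * r (sqDen i).2 t * (r (sqNum i).1 t * r (sqNum i).2 t)) with hx
  have hyx : Set.EqOn (y ^ 2) (x ^ 2) Set.univ := fun t _ => by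
    have := ratio_sq_of_residualVec (hw t) (hg t) i
    simp only [Pi.pow_apply, hy, hx, mul_pow, rsq, hk]
    linear_combination ((sqDen i).1.form (u + circ t • v) * (sqDen i).2.form (u + circ t • v)) * this
  have hx1 : x 1 = monodromySign H i * x 0 := by
    simp only [hx, rone, monodromySign]; ring
  have hy1 : y 1 = monodromySign H i * y 0 := by
    rcases isPreconnected_univ.eq_or_eq_neg_of_sq_eq
      (cR.mul ((cF _).mul (cF _))).continuousOn
      (continuous_const.mul (((rc _).mul (rc _)).mul ((rc _).mul (rc _)))).continuousOn hyx
      (fun {t} _ => mul_ne_zero hk0 (mul_ne_zero (mul_ne_zero (rne _ t) (rne _ t))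
        (mul_ne_zero (rne _ t) (rne _ t)))) with h | h
    · have a1 : y 1 = x 1 := h (Set.mem_univ 1)
      have a0 : y 0 = x 0 := h (Set.mem_univ 0)
      rw [a1, a0, hx1]
    · have a1 : y 1 = -x 1 := h (Set.mem_univ 1)
      have a0 : y 0 = -x 0 := h (Set.mem_univ 0)
      rw [a1, a0, hx1]; ring
  simp only [hy, circ_one, ← circ_zero] at hy1
  refine mul_right_cancel₀ (mul_ne_zero (hF (sqDen i).1 0) (hF (sqDen i).2 0)) ?_
  rw [hy1, Pi.mul_apply, mul_assoc]

/-- The monodromy along the boundary of a disc around a point of `H`. -/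
theorem monodromy_circle {H : SingularHyperplane} (hH : H.form nodeVec = 0) {u v : Fin 5 → ℂ}
    (hu : H.form u = 0) (h0 : GeneralVec {H} u)
    (hs : ∀ s : ℂ, ‖s‖ ≤ 1 → s ≠ 0 → GeneralVec ∅ (u + s • v))
    {b : generalLocus} (c : Path b b)
    (hc : ∀ t, (c t : P4) = Projectivization.mk ℂ (u + circ t • v)
      (hs _ (norm_circ t).le (circ_ne_zero t)).ne_zero) (z : tropeProj ⁻¹' {b}) :
    isQuotientCoveringMap_tropeProj.isCoveringMap.monodromy (.mk c) z =
      isQuotientCoveringMap_tropeProj.toPermFiber b (localMonodromy H) z := by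
  have cov := isQuotientCoveringMap_tropeProj.isCoveringMap
  have hcz : c 0 = tropeProj z := c.source.trans z.2.symm
  set Γ := cov.liftPath c z hcz with hΓ
  have lift (t : unitInterval) : tropeProj (Γ t) = c t := congrFun (cov.liftPath_lifts c z hcz) t
  have h1 := ratio_circle hu h0 hs Γ.continuous fun t => by
    have := (Γ t).plane_mem
    rwa [lift, hc, mem_tropeSet_mk_iff _ (hs _ (norm_circ t).le (circ_ne_zero t))] at this
  rw [show Γ 0 = z from cov.liftPath_zero c z hcz, ← ratio_localMonodromy hH] at h1
  have m1 : (Γ 1).plane ∈ tropeSet b := by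
    have := (Γ 1).plane_mem; rwa [lift, c.target] at this
  have m0 : z.1.plane ∈ tropeSet b := by
    have := z.1.plane_mem; rwa [show tropeProj z = b from z.2] at this
  -- Both ends of the lift lie over `b`, so they differ by some `g` in `Γ`, and the semi-invariant
  -- functions show which one.
  obtain ⟨g, hg⟩ := exists_gam_eq b.2 m0 m1
  rw [← hg] at h1
  obtain rfl := eq_of_ratio_eq (ratio_ne_zero_of_mem b.2 m0) h1
  refine Subtype.ext (TropeCover.ext ?_ ?_)
  · exact ((lift 1).trans c.target).trans ((tropeProj_smul _ _).trans z.2).symm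
  · exact hg.symm

/-- Transport along `d` commutes with `Γ`, so the element found on the circle moves past `d.symm`,
and `d` cancels against it. -/
theorem monodromyPerm_loopAround {H : SingularHyperplane} (hH : H.form nodeVec = 0)
    {p : generalLocus} {l : Path p p} (hl : IsLoopAround H l) :
    isQuotientCoveringMap_tropeProj.isCoveringMap.monodromyPerm p
      (FundamentalGroup.fromPath (Path.Homotopic.Quotient.mk l)) =
      isQuotientCoveringMap_tropeProj.toPermFiber p (localMonodromy H) := by
  have hq := isQuotientCoveringMap_tropeProj
  obtain ⟨u, v, hw, hu, h0, hs, b, c, d, hc, hlc⟩ := hl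
  have h0' : GeneralVec {H} u := by simpa using (isGeneralOutside_mk_iff _).1 h0
  have hs' (s : ℂ) (h : ‖s‖ ≤ 1) (h' : s ≠ 0) : GeneralVec ∅ (u + s • v) :=
    (mk_mem_generalLocus_iff _).1 (hs s h h')
  have hc' (t : unitInterval) : (c t : P4) = Projectivization.mk ℂ (u + circ t • v)
      (hs' _ (norm_circ t).le (circ_ne_zero t)).ne_zero := (hc t).2
  ext1 z
  change hq.isCoveringMap.monodromy (.mk l) z = _
  rw [Path.Homotopic.Quotient.eq.2 hlc, Path.Homotopic.Quotient.mk_trans,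
    Path.Homotopic.Quotient.mk_trans, IsCoveringMap.monodromy_trans_apply,
    IsCoveringMap.monodromy_trans_apply, monodromy_circle hH hu h0' hs' c hc',
    hq.monodromy_toPermFiber, ← IsCoveringMap.monodromy_trans_apply,
    ← Path.Homotopic.Quotient.mk_trans, show Path.Homotopic.Quotient.mk (d.trans d.symm) = .mk (.refl p) from
      Path.Homotopic.Quotient.eq.2 ⟨(Path.Homotopy.reflTransSymm d).symm⟩, Path.Homotopic.Quotient.mk_refl,
    IsCoveringMap.monodromy_refl]
  rfl

/-! ### The monodromy group -/

/-- A permutation commuting with a simply transitive abelian group belongs to that group: if it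
agrees with `g` at one point of the fibre, it agrees with `g` everywhere. The other inclusion needs
only that the local monodromies generate `Γ`. -/
theorem range_monodromyPerm (p : generalLocus) :
    (isQuotientCoveringMap_tropeProj.isCoveringMap.monodromyPerm p).range =
      (isQuotientCoveringMap_tropeProj.toPermFiber p).range := by
  have hq := isQuotientCoveringMap_tropeProj
  apply le_antisymm
  · rintro _ ⟨γ, rfl⟩
    obtain ⟨z₀, hz₀⟩ := surjective_tropeProj p
    obtain ⟨g, hg⟩ := hq.exists_toPermFiber_eq ⟨z₀, hz₀⟩ (hq.isCoveringMap.monodromy γ ⟨z₀, hz₀⟩)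
    refine ⟨g, Equiv.ext fun z => ?_⟩
    obtain ⟨k, rfl⟩ := hq.exists_toPermFiber_eq ⟨z₀, hz₀⟩ z
    change _ = hq.isCoveringMap.monodromy γ _
    rw [hq.monodromy_toPermFiber, ← hg, ← Equiv.Perm.mul_apply, ← Equiv.Perm.mul_apply, ← map_mul,
      ← map_mul, gam_mul_comm]
  · rw [MonoidHom.range_eq_map, Subgroup.map_le_iff_le_comap]
    set K := (hq.isCoveringMap.monodromyPerm p).range.comap (hq.toPermFiber p) with hK
    have loc {H : SingularHyperplane} (hH : H.form nodeVec = 0) : localMonodromy H ∈ K := by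
      obtain ⟨l, hl⟩ := exists_isLoopAround hH p
      exact ⟨_, monodromyPerm_loopAround hH hl⟩
    -- Four of the nine hyperplanes suffice: `γ₃`, `γ₄`, `γ₂γ₃` and `γ₁γ₂` generate `Γ`.
    have h3 : γ₃ ∈ K := loc (H := .qpC) (by simp [SingularHyperplane.form, nodeVec])
    have h4 : γ₄ ∈ K := loc (H := .qpD) (by simp [SingularHyperplane.form, nodeVec])
    have h12 : γ₁ * γ₂ ∈ K := loc (H := .pp0) (by simp [SingularHyperplane.form, nodeVec]; norm_num)
    have h23 : γ₂ * γ₃ ∈ K := loc (H := .pm1) (by simp [SingularHyperplane.form, nodeVec]; norm_num)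
    have h2 : γ₂ ∈ K := (K.mul_mem_cancel_right h3).1 h23
    have h1 : γ₁ ∈ K := (K.mul_mem_cancel_right h2).1 h12
    rintro ⟨g, hg⟩ -
    induction hg using Subgroup.closure_induction with
    | mem x hx => rcases hx with rfl | rfl | rfl | rfl; exacts [h1, h2, h3, h4]
    | one => exact K.one_mem
    | mul x y _ _ hx hy => exact K.mul_mem hx hy
    | inv x _ hx => exact K.inv_mem hx

/-- The action of `Γ` on the tropes over `p`, as an isomorphism onto the monodromy group. -/
noncomputable def gamEquivMonodromy (p : generalLocus) :
    Gam ≃* (isQuotientCoveringMap_tropeProj.isCoveringMap.monodromyPerm p).range :=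
  (MonoidHom.ofInjective (isQuotientCoveringMap_tropeProj.toPermFiber_injective p)).trans
    (MulEquiv.subgroupCongr (range_monodromyPerm p).symm)

theorem coe_gamEquivMonodromy (p : generalLocus) (g : Gam) :
    (gamEquivMonodromy p g : Equiv.Perm (tropeProj ⁻¹' {p})) =
      isQuotientCoveringMap_tropeProj.toPermFiber p g := rfl

end HeisenbergQuartic

/-! ### The monodromy of the tropes -/

open HeisenbergQuartic
theorem mainTheorem8 :
    generalLocus.Nonempty ∧
    Nonempty (Gam ≃* Multiplicative (Fin 4 → ZMod 2)) ∧
    ∃ hcov : IsCoveringMap tropeProj,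
      ∀ p : generalLocus,
        (tropeSet p).ncard = 16 ∧
        (∀ p₁ : P4, IsResidualPoint p p₁ → ∀ T ∈ tropeSet p, IsTrope (quartic p₁.rep) T) ∧
        Nonempty ((hcov.monodromyPerm p).range ≃* Multiplicative (Fin 4 → ZMod 2)) ∧
        ∃ e : Gam ≃* (hcov.monodromyPerm p).range,
          (∀ (γ : Gam) (z : tropeProj ⁻¹' {p}),
            ((e γ : Equiv.Perm (tropeProj ⁻¹' {p})) z).1.plane
              = (γ : Equiv.Perm P3) z.1.plane) ∧
          ∀ H : SingularHyperplane, H.form nodeVec = 0 →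
            (∃ l : Path p p, IsLoopAround H l) ∧
            ∀ l : Path p p, IsLoopAround H l →
              hcov.monodromyPerm p (FundamentalGroup.fromPath (Path.Homotopic.Quotient.mk l))
                = e (localMonodromy H) := by
  refine ⟨generalLocus_nonempty, ⟨gamEquiv⟩, isQuotientCoveringMap_tropeProj.isCoveringMap,
    fun p => ⟨ncard_tropeSet p.2, fun p₁ h T hT => isTrope_of_mem_tropeSet p.2 h hT,
      ⟨(gamEquivMonodromy p).symm.trans gamEquiv⟩, gamEquivMonodromy p, fun γ z => rfl,
      fun H hH => ⟨exists_isLoopAround hH p, fun l hl => ?_⟩⟩⟩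
  rw [monodromyPerm_loopAround hH hl, coe_gamEquivMonodromy]
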